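/- **Setting.** Work with four points of $\mathcal N=1$ superspace over Minkowski space with metric $(+,-,-,-)$, with Grassmann spinors $\theta_i^\alpha,\bar\theta_i^{\dot\alpha}$ ($i=1,\dots,4$), and put $\sigma^\mu=(1,\vec\sigma)$, $\tilde\sigma^\mu=(1,-\vec\sigma)$, $x_{i\pm}^\mu=x_i^\mu\mp i\,\theta_i\sigma^\mu\bar\theta_i$, $\theta_{ij}=\theta_i-\theta_j$, $\bar\theta_{ij}=\bar\theta_i-\bar\theta_j$, $$x_{\bar ij}^\mu=x_{i-}^\mu-x_{j+}^\mu-2i\,\theta_j\sigma^\mu\bar\theta_i,\qquad \mathrm x_{\bar ij}=x_{\bar ij}^\mu\sigma_\mu,\quad \tilde{\mathrm x}_{\bar ij}=x_{\bar ij}^\mu\tilde\sigma_\mu,\quad \mathrm x_{\bar ij}^{-1}=\frac{\tilde{\mathrm x}_{\bar ij}}{x_{\bar ij}^2},\quad \tilde{\mathrm x}_{\bar ij}^{-1}=\frac{\mathrm x_{\bar ij}}{x_{\bar ij}^2}.$$ A superfunction of the four points is regarded as a function of $x_{1-},x_{2-},x_{3+},x_{4+}$ and of all $\theta_i,\bar\theta_i$.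 In these coordinates $D_{i-}=\partial/\partial\theta_i$ ($i=1,2$) and $\bar D_{i+}=-\partial/\partial\bar\theta_i$ ($i=3,4$). Consider configurations (with Grassmann variables zero) in a set $U$ on which $(x_i-x_j)^2\neq0$ for $i\ne j$, with chosen values of $\log (x_i-x_j)^2$ fixing all real powers; functions of even Grassmann numbers are given by their terminating Taylor expansions around the bodies. The *cross ratios* are $$\mathcal I_1=\frac{x_{\bar14}^2x_{\bar32}^2}{x_{\bar12}^2x_{\bar34}^2},\qquad \mathcal I_2=\frac{x_{\bar14}^2x_{\bar23}^2}{x_{\bar13}^2x_{\bar24}^2},$$ which reduce to the conformal cross ratios $u=\frac{x_{14}^2x_{23}^2}{x_{12}^2x_{34}^2}$, $v=\frac{x_{14}^2x_{23}^2}{x_{13}^2x_{24}^2}$ when all Grassmann variables vanish. The eight *nilpotent invariants* are, for $i,j\in\{1,2\}$, $$I_{1ij}=-\frac{\tilde{\bar\Theta}_{1(j)}\tilde{\mathrm X}_{1(1)+}\tilde\Theta_{1(i)}}{\sqrt{X_{1(1)+}^2X_{1(1)-}^2}},\qquad I_{2ij}=-\frac{\tilde{\bar\Theta}_{1(j)}\tilde{\mathrm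 X}_{1(2)-}\tilde\Theta_{1(i)}}{\sqrt{X_{1(1)+}^2X_{1(1)-}^2}},$$ with $\tilde{\mathrm X}_{1(1)+}=-\mathrm x_{\bar14}^{-1}\mathrm x_{\bar24}\mathrm x_{\bar21}^{-1}$, $\tilde{\mathrm X}_{1(2)-}=\mathrm x_{\bar13}^{-1}\mathrm x_{\bar43}\mathrm x_{\bar41}^{-1}$, $X_{1(1)+}^2=\frac{x_{\bar24}^2}{x_{\bar21}^2x_{\bar14}^2}$, $X_{1(1)-}^2=\frac{x_{\bar42}^2}{x_{\bar41}^2x_{\bar12}^2}$, the square root having the same body as $X_{1(1)+}^2$, and for $i=2,3$: $\tilde\Theta_{1(i-1)}=i\big(\tilde{\mathrm x}_{\bar41}^{-1}\bar\theta_{41}-\tilde{\mathrm x}_{\bar i1}^{-1}\bar\theta_{i1}\big)$, $\tilde{\bar\Theta}_{1(i-1)}=i\big(\theta_{1i}\tilde{\mathrm x}_{\bar1i}^{-1}-\theta_{14}\tilde{\mathrm x}_{\bar14}^{-1}\big)$ (the prefactor $i$ is the imaginary unit). A *scalar four-point function* with dimensions $\eta_i\in\mathbb R$ and R-charges $\kappa_i\in\mathbb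 R$ is a superfunction $$G=\Big(\frac{x_{\bar12}^2}{x_{\bar21}^2}\Big)^{\Sigma_1}\Big(\frac{x_{\bar23}^2}{x_{\bar32}^2}\Big)^{\Sigma_2}\Big(\frac{x_{\bar24}^2}{x_{\bar42}^2}\Big)^{\Sigma_3}\Big(\frac{x_{\bar23}^2}{x_{\bar12}^2x_{\bar13}^2}\Big)^{\Xi}\,\frac{f_{4PF}(\mathcal I_1,\mathcal I_2,I_{111},\dots,I_{222})}{P},\qquad P=(x_{\bar13}^2)^{\eta_3-\eta_2}(x_{\bar14}^2)^{\eta_4}(x_{\bar23}^2)^{\eta_2},$$ where $\Sigma_1=\Delta_{21}+\Delta_{31}+\Delta_{41}$, $\Sigma_2=\Delta_{31}+\Delta_{32}+\Delta_{34}$, $\Sigma_3=\Delta_{41}+\Delta_{42}+\Delta_{43}$, $\Xi=\frac12(\eta_1+\eta_2-\eta_3-\eta_4)$, $\Delta_{lm}=-\frac1{12}\sum_i\eta_i+\frac14(\eta_l+\eta_m)+\frac38(\kappa_l-\kappa_m)$, and $f_{4PF}$ is a polynomial in the nilpotent invariants whose coefficients are smooth functions of $(\mathcal I_1,\mathcal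 I_2)$, defined on an open set $V\subseteq\mathbb R^2$ containing all $(u,v)$ attained on $U$; $f_{0,1}$ denotes the coefficient of the monomial $1$. It is a *chiral four-point function* $\langle\bar\Phi_1(z_{1-})\bar\Phi_2(z_{2-})\Phi_3(z_{3+})\Phi_4(z_{4+})\rangle$ with vanishing total R-charge if moreover $\kappa_1=\frac{\eta_1}3$, $\kappa_2=\frac{\eta_2}3$, $\kappa_3=-\frac{\eta_3}3$, $\kappa_4=-\frac{\eta_4}3$, $\sum_i\kappa_i=0$ and $D_{1-}G=D_{2-}G=\bar D_{3+}G=\bar D_{4+}G=0$. **Theorem.** Let $G$ be a chiral four-point function with vanishing total R-charge, and suppose that $f_{0,1}$ is a (Laurent) power series, $f_{0,1}(u,v)=\sum_{k_1,k_2\in\mathbb Z}f_{0,1,k_1,k_2}\,u^{k_1}v^{k_2}$, converging unconditionally at all points of $V$ with $u,v\ne0$. Then on $U$ $$G=\frac{\sum_{k_1,k_2}f_{0,1,k_1,k_2}\,{\mathcal I_1'}^{k_1}\,\mathcal I_2^{k_2}}{(x_{\bar13}^2)^{\eta_3-\eta_2}(x_{\bar14}^2)^{\eta_4}(x_{\bar23}^2)^{\eta_2}}$$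 (with unconditional convergence of each Grassmann component), where $$\mathcal I_1'=e^{4i(\gamma-2i\gamma^2)}\,\frac{x_{\bar14}^2x_{\bar23}^2}{N},\qquad N=(x_{\bar13}-x_{\bar23})^2(x_{\bar13}-x_{\bar14})^2,$$ $$\gamma=\frac{\theta_{34}\,\mathrm x_{\bar14}\tilde{\mathrm x}_{\bar13}\mathrm x_{\bar23}\,\bar\theta_{21}-x_{\bar13}^2\big(\theta_{34}\mathrm x_{\bar23}\bar\theta_{21}+\theta_{34}\mathrm x_{\bar14}\bar\theta_{21}-\theta_{34}\mathrm x_{\bar13}\bar\theta_{21}\big)}{N}.$$ Moreover $\mathcal I_1'$, $\mathcal I_2$ and $P$ depend only on the anti-chiral and chiral variables $z_{1-},z_{2-},z_{3+},z_{4+}$, where $z_{i-}=(x_{i-},\bar\theta_i)$ and $z_{i+}=(x_{i+},\theta_i)$ (they are annihilated by $D_{1-},D_{2-},\bar D_{3+},\bar D_{4+}$). When all Grassmann variables are set to zero, $\mathcal I_1'$ and $\mathcal I_2$ become the conformal cross ratios $u$ and $v$, and the conformal four-point function of the lowest, scalar components is $\sum_{k_1,k_2}f_{0,1,k_1,k_2}u^{k_1}v^{k_2}$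 over $(x_{13}^2)^{\eta_3-\eta_2}(x_{14}^2)^{\eta_4}(x_{23}^2)^{\eta_2}$, with the same coefficients $f_{0,1,k_1,k_2}$. -/

import Mathlib

/-! Superfunctions of four points of `N = 1` superspace.  The points `1, 2, 3, 4` carry the
indices `0, 1, 2, 3 : Fin 4`; Lorentz indices are `Fin 4`, spinor indices `Fin 2`. -/

namespace SuperFourPoint

/-- The complex Grassmann algebra on the sixteen generators `θ_i^α` and `θbar_i^α̇`. -/
abbrev Gr : Type := ExteriorAlgebra ℂ ((Fin 4 × Fin 2) ⊕ (Fin 4 × Fin 2) → ℂ)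

/-- The Grassmann spinor `θ_i^α`. -/
noncomputable def theta (i : Fin 4) (α : Fin 2) : Gr :=
  ExteriorAlgebra.ι ℂ (Pi.single (Sum.inl (i, α)) 1)

/-- The Grassmann spinor `θbar_i^α̇`. -/
noncomputable def thetaBar (i : Fin 4) (β : Fin 2) : Gr :=
  ExteriorAlgebra.ι ℂ (Pi.single (Sum.inr (i, β)) 1)

/-- The value of a Grassmann number when all Grassmann variables are set to zero. -/
noncomputable def body (a : Gr) : ℂ := ExteriorAlgebra.algebraMapInv a

/-- Complex numbers as Grassmann numbers. -/
noncomputable def cst (c : ℂ) : Gr := algebraMap ℂ Gr c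

/-- The left derivative `∂/∂θ_i^α`. -/
noncomputable def dTheta (i : Fin 4) (α : Fin 2) (a : Gr) : Gr :=
  CliffordAlgebra.contractLeft (LinearMap.proj (Sum.inl (i, α))) a

/-- The left derivative `∂/∂θbar_i^α̇`. -/
noncomputable def dThetaBar (i : Fin 4) (β : Fin 2) (a : Gr) : Gr :=
  CliffordAlgebra.contractLeft (LinearMap.proj (Sum.inr (i, β))) a

/-! ### Coordinates

A superfunction of four points is a function of the even coordinates
`x_{1-}, x_{2-}, x_{3+}, x_{4+}` and of all `θ_i, θbar_i`, that is, a map from the (bodies of the)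
even coordinates to the Grassmann algebra. -/

/-- The even coordinates `x_{1-}, x_{2-}, x_{3+}, x_{4+}` in `(ℝ^{1,3})^4`. -/
abbrev Config : Type := Fin 4 → Fin 4 → ℝ

/-- The anti-chiral covariant derivative `D_{i-}` in the coordinates `(x_{i-}, θ_i, θbar_i)`. -/
noncomputable def DMinus (i : Fin 4) (α : Fin 2) (a : Gr) : Gr := dTheta i α a

/-- The chiral covariant derivative `Dbar_{i+}` in the coordinates `(x_{i+}, θ_i, θbar_i)`. -/
noncomputable def DBarPlus (i : Fin 4) (β : Fin 2) (a : Gr) : Gr := -dThetaBar i β a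

/-- The chirality conditions `D_{1-} G = D_{2-} G = 0` and `Dbar_{3+} G = Dbar_{4+} G = 0`, at a
point: `G` depends on `z_{1-}, z_{2-}, z_{3+}, z_{4+}` only. -/
def IsChiral (a : Gr) : Prop :=
  ∀ α : Fin 2, DMinus 0 α a = 0 ∧ DMinus 1 α a = 0 ∧ DBarPlus 2 α a = 0 ∧ DBarPlus 3 α a = 0

/-- The Minkowski metric `diag (1, -1, -1, -1)`. -/
def metric (μ : Fin 4) : ℝ := if μ = 0 then 1 else -1

/-- `x_{ij}^2` with all Grassmann variables set to zero. -/
def mink (x : Config) (i j : Fin 4) : ℝ := ∑ μ, metric μ * (x i μ - x j μ) ^ 2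

/-- The matrices `σ^μ = (1, Pauli matrices)`. -/
noncomputable def sigma (μ : Fin 4) : Matrix (Fin 2) (Fin 2) ℂ :=
  (![!![1, 0; 0, 1], !![0, 1; 1, 0], !![0, -Complex.I; Complex.I, 0], !![1, 0; 0, -1]] :
    Fin 4 → Matrix (Fin 2) (Fin 2) ℂ) μ

/-- The matrices `σtilde^μ = (1, -Pauli matrices)`. -/
noncomputable def sigmaTilde (μ : Fin 4) : Matrix (Fin 2) (Fin 2) ℂ := (metric μ : ℂ) • sigma μ

/-- `t σ^μ b = t^α σ^μ_{αα̇} b^α̇`. -/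
noncomputable def bilin (t b : Fin 2 → Gr) (μ : Fin 4) : Gr :=
  ∑ α, ∑ β, sigma μ α β • (t α * b β)

/-- `x_{i-} = x_i + i θ_i σ θbar_i`; in particular `x_{i-} - x_{i+} = 2 i θ_i σ θbar_i`. -/
noncomputable def xMinus (x : Config) (i μ : Fin 4) : Gr :=
  if i = 0 ∨ i = 1 then cst (x i μ)
  else cst (x i μ) + (2 * Complex.I) • bilin (theta i) (thetaBar i) μ

/-- `x_{i+} = x_i - i θ_i σ θbar_i`. -/
noncomputable def xPlus (x : Config) (i μ : Fin 4) : Gr :=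
  if i = 0 ∨ i = 1 then cst (x i μ) - (2 * Complex.I) • bilin (theta i) (thetaBar i) μ
  else cst (x i μ)

/-- The interval `x_{ibar j} = x_{i-} - x_{j+} - 2 i θ_j σ θbar_i`. -/
noncomputable def xi (x : Config) (i j μ : Fin 4) : Gr :=
  xMinus x i μ - xPlus x j μ - (2 * Complex.I) • bilin (theta j) (thetaBar i) μ

noncomputable def thetaD (i j : Fin 4) (α : Fin 2) : Gr := theta i α - theta j α

noncomputable def thetaBarD (i j : Fin 4) (β : Fin 2) : Gr := thetaBar i β - thetaBar j β

/-- The Minkowski square `v^μ v_μ`. -/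
noncomputable def sq (v : Fin 4 → Gr) : Gr := ∑ μ, (metric μ : ℂ) • (v μ * v μ)

/-- `v^μ σ_μ`, with lower spinor indices `αα̇`. -/
noncomputable def slash (v : Fin 4 → Gr) : Matrix (Fin 2) (Fin 2) Gr :=
  fun α β => ∑ μ, ((metric μ : ℂ) * sigma μ α β) • v μ

/-- `v^μ σtilde_μ`, with upper spinor indices `α̇α`. -/
noncomputable def slashTilde (v : Fin 4 → Gr) : Matrix (Fin 2) (Fin 2) Gr :=
  fun β α => ∑ μ, ((metric μ : ℂ) * sigmaTilde μ β α) • v μ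

/-- `x_{ibar j}^2`. -/
noncomputable def xiSq (x : Config) (i j : Fin 4) : Gr := sq (xi x i j)

/-- The matrix `x_{ibar j}` with lower indices. -/
noncomputable def xm (x : Config) (i j : Fin 4) : Matrix (Fin 2) (Fin 2) Gr := slash (xi x i j)

/-- The matrix `xtilde_{ibar j}` with upper indices. -/
noncomputable def xt (x : Config) (i j : Fin 4) : Matrix (Fin 2) (Fin 2) Gr :=
  slashTilde (xi x i j)

/-- `x_{ibar j}^{-1} = xtilde_{ibar j} / x_{ibar j}^2`. -/
noncomputable def xmInv (x : Config) (i j : Fin 4) : Matrix (Fin 2) (Fin 2) Gr :=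
  Ring.inverse (xiSq x i j) • xt x i j

/-- `xtilde_{ibar j}^{-1} = x_{ibar j} / x_{ibar j}^2`. -/
noncomputable def xtInv (x : Config) (i j : Fin 4) : Matrix (Fin 2) (Fin 2) Gr :=
  Ring.inverse (xiSq x i j) • xm x i j

/-- The contraction of a row spinor, a matrix and a column spinor. -/
noncomputable def sandwich (r : Fin 2 → Gr) (A : Matrix (Fin 2) (Fin 2) Gr) (c : Fin 2 → Gr) : Gr :=
  ∑ α, ∑ β, r α * A α β * c β

/-! ### Functions of even Grassmann numbers, by their (terminating) Taylor expansions

There are sixteen generators, so the seventeenth power of a Grassmann number without body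
vanishes. -/

/-- `a ^ s`, for `a` with body `1`, by the binomial series. -/
noncomputable def binom (s : ℝ) (a : Gr) : Gr :=
  ∑ k ∈ Finset.range 17, ((Ring.choose s k : ℝ) : ℂ) • (a - 1) ^ k

/-- `a ^ s` for the value `l` of the logarithm of the body of `a`. -/
noncomputable def powLog (s : ℝ) (l : ℂ) (a : Gr) : Gr :=
  Complex.exp (s * l) • binom s (Complex.exp (-l) • a)

/-- The square root with body `r` of a Grassmann number `a` with body `r ^ 2`. -/
noncomputable def sqrtBody (r : ℂ) (a : Gr) : Gr := r • binom (1 / 2) ((r ^ 2)⁻¹ • a)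

/-- Integral powers. -/
noncomputable def intPow (a : Gr) (k : ℤ) : Gr :=
  if 0 ≤ k then a ^ k.toNat else Ring.inverse a ^ (-k).toNat

/-- The mixed derivative `∂^p/∂u^p ∂^q/∂v^q f (u, v)`. -/
noncomputable def mixedDeriv (f : ℝ → ℝ → ℂ) (p q : ℕ) (u v : ℝ) : ℂ :=
  iteratedDeriv p (fun s => iteratedDeriv q (fun t => f s t) v) u

/-- `f (a, b)` for a smooth function `f` of two real variables and two even Grassmann numbers with
real bodies. -/
noncomputable def evalTwo (f : ℝ → ℝ → ℂ) (a b : Gr) : Gr :=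
  ∑ p ∈ Finset.range 17, ∑ q ∈ Finset.range 17,
    (mixedDeriv f p q (body a).re (body b).re / ((p.factorial : ℂ) * (q.factorial : ℂ))) •
      ((a - cst (body a)) ^ p * (b - cst (body b)) ^ q)

/-- Unconditional convergence in the finite-dimensional space `Gr`, tested on all linear forms. -/
def GrHasSum {ι : Type} (F : ι → Gr) (S : Gr) : Prop :=
  ∀ φ : Gr →ₗ[ℂ] ℂ, HasSum (fun k => φ (F k)) (φ S)

/-! ### Superconformal invariants of four points -/

/-- The cross ratio `𝓘₁`. -/
noncomputable def crossOne (x : Config) : Gr :=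
  xiSq x 0 3 * xiSq x 2 1 * Ring.inverse (xiSq x 0 1 * xiSq x 2 3)

/-- The cross ratio `𝓘₂`. -/
noncomputable def crossTwo (x : Config) : Gr :=
  xiSq x 0 3 * xiSq x 1 2 * Ring.inverse (xiSq x 0 2 * xiSq x 1 3)

/-- The ordinary cross ratio to which `𝓘₁` reduces. -/
noncomputable def confOne (x : Config) : ℝ :=
  (mink x 0 3 * mink x 1 2) / (mink x 0 1 * mink x 2 3)

/-- The ordinary cross ratio to which `𝓘₂` reduces. -/
noncomputable def confTwo (x : Config) : ℝ :=
  (mink x 0 3 * mink x 1 2) / (mink x 0 2 * mink x 1 3)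

/-- `X_{1(1)+}^2`. -/
noncomputable def XPlusSq (x : Config) : Gr :=
  xiSq x 1 3 * Ring.inverse (xiSq x 1 0 * xiSq x 0 3)

/-- `X_{1(1)-}^2`. -/
noncomputable def XMinusSq (x : Config) : Gr :=
  xiSq x 3 1 * Ring.inverse (xiSq x 3 0 * xiSq x 0 1)

/-- The square root of `X_{1(1)+}^2 X_{1(1)-}^2`, with body that of `X_{1(1)+}^2`. -/
noncomputable def invNorm (x : Config) : Gr :=
  sqrtBody (body (XPlusSq x)) (XPlusSq x * XMinusSq x)

/-- `Xtilde_{1(1)+}` (index `0`) and `Xtilde_{1(2)-}` (index `1`). -/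
noncomputable def XTilde (x : Config) (a : Fin 2) : Matrix (Fin 2) (Fin 2) Gr :=
  if a = 0 then -(xmInv x 0 3 * xm x 1 3 * xmInv x 1 0)
  else xmInv x 0 2 * xm x 3 2 * xmInv x 3 0

/-- The point `2` for `i = 0` and the point `3` for `i = 1`. -/
def pt (i : Fin 2) : Fin 4 := i.succ.castSucc

/-- The spinors `Θtilde_{1(1)}`, `Θtilde_{1(2)}` (lower undotted index). -/
noncomputable def bigTheta (x : Config) (i α : Fin 2) : Gr :=
  Complex.I • ((xtInv x 3 0).mulVec (thetaBarD 3 0) α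
    - (xtInv x (pt i) 0).mulVec (thetaBarD (pt i) 0) α)

/-- The spinors `Θbartilde_{1(1)}`, `Θbartilde_{1(2)}` (lower dotted index). -/
noncomputable def bigThetaBar (x : Config) (i β : Fin 2) : Gr :=
  Complex.I • (Matrix.vecMul (thetaD 0 (pt i)) (xtInv x 0 (pt i)) β
    - Matrix.vecMul (thetaD 0 3) (xtInv x 0 3) β)

/-- The nilpotent invariants `I_{aij}`, `a, i, j = 1, 2`. -/
noncomputable def nilInv (x : Config) (p : Fin 2 × Fin 2 × Fin 2) : Gr :=
  -(sandwich (bigThetaBar x p.2.2) (XTilde x p.1) (bigTheta x p.2.1) * Ring.inverse (invNorm x))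

/-- Exponents of the eight nilpotent invariants; the third power of each of these vanishes. -/
abbrev Expo : Type := Fin 2 × Fin 2 × Fin 2 → Fin 3

/-- The monomial in the nilpotent invariants with exponents `e`. -/
noncomputable def nilMon (x : Config) (e : Expo) : Gr :=
  (([(0, 0, 0), (0, 0, 1), (0, 1, 0), (0, 1, 1), (1, 0, 0), (1, 0, 1), (1, 1, 0), (1, 1, 1)] :
    List (Fin 2 × Fin 2 × Fin 2)).map fun p => nilInv x p ^ (e p : ℕ)).prod

/-- A smooth function `f_{4PF} (𝓘₁, 𝓘₂, I_{111}, …, I_{222})` of all invariants of four points, by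
its expansion in the nilpotent ones.  Its zeroth order coefficient `f_{0,1}` is `f 0`. -/
noncomputable def fourPF (f : Expo → ℝ → ℝ → ℂ) (x : Config) : Gr :=
  ∑ e : Expo, evalTwo (f e) (crossOne x) (crossTwo x) * nilMon x e

/-! ### Four-point functions -/

/-- The exponents `Δ_{lm}` of the scalar four-point function with dimensions `η` and R-charges
`κ`. -/
noncomputable def Delta (η κ : Fin 4 → ℝ) (l m : Fin 4) : ℝ :=
  -(1 / (2 * (4 - 1) * (4 - 2))) * ∑ i, η i + 1 / (2 * (4 - 2)) * (η l + η m)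
    + 3 / (2 * 4) * (κ l - κ m)

/-- The factor `x_{1bar 3}^{2(η₃-η₂)} x_{1bar 4}^{2η₄} x_{2bar 3}^{2η₂}`, for given values `l i j` of the
logarithms of `x_{ij}^2`. -/
noncomputable def prefactor (η : Fin 4 → ℝ) (l : Fin 4 → Fin 4 → ℂ) (x : Config) : Gr :=
  powLog (η 2 - η 1) (l 0 2) (xiSq x 0 2) * powLog (η 3) (l 0 3) (xiSq x 0 3)
    * powLog (η 1) (l 1 2) (xiSq x 1 2)

/-- The same factor with all Grassmann variables set to zero. -/
noncomputable def confPrefactor (η : Fin 4 → ℝ) (l : Fin 4 → Fin 4 → ℂ) : ℂ :=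
  Complex.exp ((η 2 - η 1) * l 0 2) * Complex.exp (η 3 * l 0 3) * Complex.exp (η 1 * l 1 2)

/-- The general scalar four-point function with dimensions `η`, R-charges `κ` and invariant part
`f_{4PF}`. -/
noncomputable def scalarFourPoint (η κ : Fin 4 → ℝ) (f : Expo → ℝ → ℝ → ℂ)
    (l : Fin 4 → Fin 4 → ℂ) (x : Config) : Gr :=
  powLog (Delta η κ 1 0 + Delta η κ 2 0 + Delta η κ 3 0) 0
      (xiSq x 0 1 * Ring.inverse (xiSq x 1 0))
    * powLog (Delta η κ 2 0 + Delta η κ 2 1 + Delta η κ 2 3) 0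
      (xiSq x 1 2 * Ring.inverse (xiSq x 2 1))
    * powLog (Delta η κ 3 0 + Delta η κ 3 1 + Delta η κ 3 2) 0
      (xiSq x 1 3 * Ring.inverse (xiSq x 3 1))
    * powLog ((η 0 + η 1 - η 2 - η 3) / 2) (l 1 2 - l 0 1 - l 0 2)
      (xiSq x 1 2 * Ring.inverse (xiSq x 0 1 * xiSq x 0 2))
    * fourPF f x * Ring.inverse (prefactor η l x)

/-- `(x_{1bar 3} - x_{2bar 3})^2`. -/
noncomputable def chiralSqOneTwo (x : Config) : Gr := sq (fun μ => xi x 0 2 μ - xi x 1 2 μ)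

/-- `(x_{1bar 3} - x_{1bar 4})^2`. -/
noncomputable def chiralSqThreeFour (x : Config) : Gr := sq (fun μ => xi x 0 2 μ - xi x 0 3 μ)

/-- The nilpotent quantity `γ`. -/
noncomputable def gammaNil (x : Config) : Gr :=
  sandwich (thetaD 2 3) (xm x 0 3 * xt x 0 2 * xm x 1 2) (thetaBarD 1 0)
      * Ring.inverse (chiralSqOneTwo x * chiralSqThreeFour x)
    - xiSq x 0 2
      * (sandwich (thetaD 2 3) (xm x 1 2) (thetaBarD 1 0)
        + sandwich (thetaD 2 3) (xm x 0 3) (thetaBarD 1 0)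
        - sandwich (thetaD 2 3) (xm x 0 2) (thetaBarD 1 0))
      * Ring.inverse (chiralSqOneTwo x * chiralSqThreeFour x)

/-- The modified cross ratio `𝓘₁'`. -/
noncomputable def crossOnePrime (x : Config) : Gr :=
  IsNilpotent.exp ((4 * Complex.I) • (gammaNil x - (2 * Complex.I) • gammaNil x ^ 2))
    * (xiSq x 0 3 * xiSq x 1 2 * Ring.inverse (chiralSqOneTwo x * chiralSqThreeFour x))

end SuperFourPoint

/-! With these R-charges all extra exponents vanish, so `G` is `fourPF / P`. Since `P` is built from
chiral intervals, `fourPF` itself depends only on `θ_3, θ_4, θbar_1, θbar_2`. It is therefore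
unchanged by any substitution `phi` of odd elements for the other variables `θ_1, θ_2, θbar_3,
θbar_4`. The proof chooses one under which every nilpotent invariant vanishes: then only the
coefficient `f 0` survives, evaluated at the images of the two cross ratios (`fourPF_eq_evalTwo`).
The second cross ratio is chiral and stays; the first becomes `𝓘₁'`.

The choice is `θ_1, θ_2 ↦ θ_4`, with `θbar_31` and `θbar_41` replaced by matrices applied to
`θbar_21` so that the three spinors `xtilde_{ibar 1}^{-1} θbar_{i1}`, `i = 2, 3, 4`, coincide
(`phi_bigTheta`). The image of the first cross ratio is a quotient of 2 × 2 determinants. Its only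
nontrivial factor has the form `det (1 + P M)` with `M` made of products of anticommuting
quantities; this is the inverse of `1 - tr (P M)`, with `(tr (P M)) ^ 3 = 0`
(`IsOddProduct.cross_ratio`). Hence the factor `1 + 4iγ`, which equals the exponential in `𝓘₁'`
because `γ ^ 3 = 0`.

To insert Grassmann numbers into the Laurent series, the series is differentiated term by term
(`hasSum_mixedDeriv`). The finite Taylor expansion then matches the binomial expansion of each
integral power (`grHasSum_evalTwo`). Even quantities are handled in the centre `Z`, a commutative
ring over which determinants and inverse matrices are available. -/

namespace SuperFourPoint

open ExteriorAlgebra (ι)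

/-! ### Grassmann algebra: even and odd elements -/

/-- The labels of the sixteen Grassmann generators. -/
abbrev Label : Type := (Fin 4 × Fin 2) ⊕ (Fin 4 × Fin 2)

/-- The Grassmann generator with a given label. -/
noncomputable def gen (k : Label) : Gr := ι ℂ (Pi.single k 1)

theorem gr_induction {P : Gr → Prop} (hC : ∀ r : ℂ, P (algebraMap ℂ Gr r))
    (hadd : ∀ x y, P x → P y → P (x + y)) (hmul : ∀ x v, P x → P (ι ℂ v * x)) (a : Gr) : P a :=
  CliffordAlgebra.left_induction (Q := 0) hC hadd hmul a

theorem ι_mul_comm_neg (v w : Label → ℂ) : (ι ℂ v * ι ℂ w : Gr) = -(ι ℂ w * ι ℂ v) :=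
  eq_neg_of_add_eq_zero_left (ExteriorAlgebra.ι_add_mul_swap v w)

/-- The centre of the Grassmann algebra, which contains all even elements. -/
abbrev Z : Subalgebra ℂ Gr := Subalgebra.center ℂ Gr

theorem mem_Z_iff {a : Gr} : a ∈ Z ↔ ∀ b, a * b = b * a := by
  rw [Subalgebra.mem_center_iff]
  exact ⟨fun h b => (h b).symm, fun h b => (h b).symm⟩

theorem ι_mul_ι_mem_Z (v w : Label → ℂ) : (ι ℂ v * ι ℂ w : Gr) ∈ Z := by
  rw [mem_Z_iff]
  intro b
  induction b using gr_induction with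
  | hC r => exact (Algebra.commutes r _).symm
  | hadd x y hx hy => rw [mul_add, add_mul, hx, hy]
  | hmul x u hx =>
    have h : (ι ℂ v * ι ℂ w * ι ℂ u : Gr) = ι ℂ u * (ι ℂ v * ι ℂ w) := by
      rw [mul_assoc, ι_mul_comm_neg w u, mul_neg, ← mul_assoc, ι_mul_comm_neg v u, neg_mul, neg_neg,
        mul_assoc]
    rw [← mul_assoc, h, mul_assoc, hx, mul_assoc]

/-- Commutativity is what gives access to determinants, adjugates and inverses of matrices with even
entries. -/
noncomputable instance instCommRingZ : CommRing Z :=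
  { (inferInstance : Ring Z) with mul_comm := fun a b => Subtype.ext (mem_Z_iff.1 a.2 b) }

/-- The module of odd elements over the centre. -/
noncomputable def Odd : Submodule Z Gr := Submodule.span Z (Set.range (ι ℂ : (Label → ℂ) → Gr))

theorem ι_mem_Odd (v : Label → ℂ) : (ι ℂ v : Gr) ∈ Odd := Submodule.subset_span ⟨v, rfl⟩

theorem gen_mem_Odd (k : Label) : gen k ∈ Odd := ι_mem_Odd _

theorem smul_mem_Odd (c : ℂ) {a : Gr} (ha : a ∈ Odd) : c • a ∈ Odd := by
  have h := Odd.smul_mem (algebraMap ℂ Z c) ha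
  rwa [algebraMap_smul] at h

theorem Odd_mul_mem_Z {a b : Gr} (ha : a ∈ Odd) (hb : b ∈ Odd) : a * b ∈ Z := by
  induction ha, hb using Submodule.span_induction₂ with
  | mem_mem x y hx hy =>
    obtain ⟨v, rfl⟩ := hx
    obtain ⟨w, rfl⟩ := hy
    exact ι_mul_ι_mem_Z v w
  | zero_left y _ => rw [zero_mul]; exact Z.zero_mem
  | zero_right y _ => rw [mul_zero]; exact Z.zero_mem
  | add_left x y z _ _ _ h₁ h₂ => rw [add_mul]; exact Z.add_mem h₁ h₂
  | add_right x y z _ _ _ h₁ h₂ => rw [mul_add]; exact Z.add_mem h₁ h₂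
  | smul_left r x y _ _ h =>
    rw [Subalgebra.smul_def, smul_eq_mul, mul_assoc]
    exact Z.mul_mem r.2 h
  | smul_right r x y _ _ h =>
    rw [Subalgebra.smul_def, smul_eq_mul, ← mul_assoc, ← mem_Z_iff.1 r.2, mul_assoc]
    exact Z.mul_mem r.2 h

theorem Odd_mul_comm_neg {a b : Gr} (ha : a ∈ Odd) (hb : b ∈ Odd) : a * b = -(b * a) := by
  induction ha, hb using Submodule.span_induction₂ with
  | mem_mem x y hx hy =>
    obtain ⟨v, rfl⟩ := hx
    obtain ⟨w, rfl⟩ := hy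
    exact ι_mul_comm_neg v w
  | zero_left y _ => simp
  | zero_right y _ => simp
  | add_left x y z _ _ _ h₁ h₂ => rw [add_mul, h₁, h₂, mul_add, neg_add]
  | add_right x y z _ _ _ h₁ h₂ => rw [mul_add, h₁, h₂, add_mul, neg_add]
  | smul_left r x y _ _ h =>
    rw [Subalgebra.smul_def, smul_eq_mul, mul_assoc, h, ← mul_assoc y, ← mem_Z_iff.1 r.2 y,
      mul_assoc, mul_neg]
  | smul_right r x y _ _ h =>
    rw [Subalgebra.smul_def, smul_eq_mul, ← mul_assoc, ← mem_Z_iff.1 r.2 x, mul_assoc, h,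
      mul_neg, mul_assoc]

theorem Odd_mul_self {a : Gr} (ha : a ∈ Odd) : a * a = 0 := by
  have h := Odd_mul_comm_neg ha ha
  have h2 : (2 : ℂ) • (a * a) = 0 := by
    rw [two_smul]; nth_rewrite 1 [h]; exact neg_add_cancel _
  exact (smul_eq_zero.1 h2).resolve_left two_ne_zero

/-! ### Substitutions for the Grassmann variables -/

/-- The linear substitution sending each generator to its image. -/
noncomputable def substLin (im : Label → Gr) : (Label → ℂ) →ₗ[ℂ] Gr :=
  Fintype.linearCombination ℂ im

theorem substLin_mem_Odd {im : Label → Gr} (him : ∀ k, im k ∈ Odd) (v : Label → ℂ) :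
    substLin im v ∈ Odd := by
  rw [substLin, Fintype.linearCombination_apply]
  exact Odd.sum_mem fun k _ => smul_mem_Odd _ (him k)

/-- The substitution of odd elements for the generators. -/
noncomputable def subst (im : Label → Gr) (him : ∀ k, im k ∈ Odd) : Gr →ₐ[ℂ] Gr :=
  ExteriorAlgebra.lift ℂ ⟨substLin im, fun v => Odd_mul_self (substLin_mem_Odd him v)⟩

theorem subst_gen (im : Label → Gr) (him : ∀ k, im k ∈ Odd) (k : Label) :
    subst im him (gen k) = im k := by
  rw [subst, gen, ExteriorAlgebra.lift_ι_apply, substLin, Fintype.linearCombination_apply_single,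
    one_smul]

theorem gr_hom_ext {A : Type*} [Semiring A] [Algebra ℂ A] {φ ψ : Gr →ₐ[ℂ] A}
    (h : ∀ k, φ (gen k) = ψ (gen k)) : φ = ψ := by
  apply ExteriorAlgebra.hom_ext
  apply LinearMap.pi_ext'
  intro k
  ext
  exact h k

/-- The linear map that sets the variables in `S` to zero. -/
noncomputable def restrictLin (S : Finset Label) : (Label → ℂ) →ₗ[ℂ] (Label → ℂ) :=
  LinearMap.pi fun k => if k ∈ S then 0 else LinearMap.proj k

theorem restrictLin_apply (S : Finset Label) (v : Label → ℂ) (k : Label) :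
    restrictLin S v k = if k ∈ S then 0 else v k := by
  rw [restrictLin, LinearMap.pi_apply]
  split_ifs <;> rfl

/-- Setting the Grassmann variables in `S` to zero. -/
noncomputable def killSet (S : Finset Label) : Gr →ₐ[ℂ] Gr := ExteriorAlgebra.map (restrictLin S)

theorem killSet_ι (S : Finset Label) (v : Label → ℂ) :
    killSet S (ι ℂ v) = ι ℂ (restrictLin S v) := ExteriorAlgebra.map_apply_ι _ _

theorem killSet_gen (S : Finset Label) (k : Label) :
    killSet S (gen k) = if k ∈ S then 0 else gen k := by
  rw [gen, killSet_ι]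
  split_ifs with h
  · rw [← map_zero (ι ℂ : (Label → ℂ) →ₗ[ℂ] Gr)]
    congr 1
    ext j
    rw [restrictLin_apply]
    split_ifs with hj
    · rfl
    · exact Pi.single_eq_of_ne (fun e : j = k => hj (by rwa [e])) _
  · congr 1
    ext j
    rw [restrictLin_apply]
    split_ifs with hj
    · have e : j ≠ k := fun e => h (by rwa [← e])
      simp [e]
    · rfl

/-- The left derivative along a generator. -/
noncomputable def dGen (k : Label) (a : Gr) : Gr :=
  CliffordAlgebra.contractLeft (LinearMap.proj k) a

theorem dGen_add (k : Label) (a b : Gr) : dGen k (a + b) = dGen k a + dGen k b :=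
  map_add _ a b

theorem dGen_ι_mul (k : Label) (v : Label → ℂ) (a : Gr) :
    dGen k (ι ℂ v * a) = v k • a - ι ℂ v * dGen k a :=
  CliffordAlgebra.contractLeft_ι_mul _ _ _

theorem dGen_algebraMap (k : Label) (r : ℂ) : dGen k (algebraMap ℂ Gr r) = 0 :=
  CliffordAlgebra.contractLeft_algebraMap _ _ r

theorem restrictLin_singleton (k : Label) (v : Label → ℂ) :
    restrictLin {k} v = v - v k • Pi.single k 1 := by
  ext j
  rw [restrictLin_apply, Pi.sub_apply, Pi.smul_apply]
  by_cases h : j = k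
  · subst h; simp
  · simp [h]

/-- The expansion in a single generator. -/
theorem eq_killSet_add (k : Label) (a : Gr) : a = killSet {k} a + gen k * dGen k a := by
  induction a using gr_induction with
  | hC r => rw [AlgHom.commutes, dGen_algebraMap, mul_zero, add_zero]
  | hadd x y hx hy =>
    rw [map_add, dGen_add, mul_add, add_add_add_comm, ← hx, ← hy]
  | hmul x v hx =>
    have h0 : gen k * killSet {k} x = gen k * x := by
      conv_rhs => rw [hx]
      rw [mul_add, ← mul_assoc, gen, ExteriorAlgebra.ι_sq_zero, zero_mul, add_zero]
    have h1 : gen k * (ι ℂ v * dGen k x) = -(ι ℂ v * (gen k * dGen k x)) := by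
      rw [← mul_assoc, gen, ι_mul_comm_neg, neg_mul, mul_assoc]
    rw [map_mul, killSet_ι, restrictLin_singleton, map_sub, map_smul, dGen_ι_mul, sub_mul, mul_sub,
      h1, smul_mul_assoc, ← gen, h0, mul_smul_comm, sub_neg_eq_add]
    nth_rewrite 1 [hx]
    rw [mul_add]
    abel

theorem killSet_singleton_eq_self {k : Label} {a : Gr} (h : dGen k a = 0) : killSet {k} a = a := by
  have h' := eq_killSet_add k a
  rw [h, mul_zero, add_zero] at h'
  exact h'.symm

theorem dGen_killSet {S : Finset Label} {k : Label} (hk : k ∈ S) (a : Gr) :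
    dGen k (killSet S a) = 0 := by
  induction a using gr_induction with
  | hC r => rw [AlgHom.commutes, dGen_algebraMap]
  | hadd x y hx hy => rw [map_add, dGen_add, hx, hy, add_zero]
  | hmul x v hx =>
    rw [map_mul, killSet_ι, dGen_ι_mul, hx, restrictLin_apply, if_pos hk, zero_smul, mul_zero,
      sub_zero]

theorem killSet_insert (S : Finset Label) (k : Label) :
    killSet (insert k S) = (killSet S).comp (killSet {k}) := by
  apply gr_hom_ext
  intro j
  rw [AlgHom.comp_apply, killSet_gen, killSet_gen]
  by_cases hj : j = k
  · simp [hj]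
  · simp [hj, killSet_gen]

/-- By the one-variable expansion a vanishing derivative means that the variable is absent; the
variables of `S` are then removed one at a time. -/
theorem killSet_eq_self_iff (S : Finset Label) (a : Gr) :
    killSet S a = a ↔ ∀ k ∈ S, dGen k a = 0 := by
  refine ⟨fun h k hk => h ▸ dGen_killSet hk a, fun h => ?_⟩
  induction S using Finset.induction_on with
  | empty =>
    have : killSet ∅ = AlgHom.id ℂ Gr := gr_hom_ext fun k => by rw [killSet_gen]; simp
    rw [this]; rfl
  | insert k S _ ih =>
    rw [killSet_insert, AlgHom.comp_apply,
      killSet_singleton_eq_self (h k (Finset.mem_insert_self k S))]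
    exact ih fun j hj => h j (Finset.mem_insert_of_mem hj)

/-- An element free of the variables in `S` does not see what is substituted for them. This lets
chirality be exploited through a single well-chosen substitution. -/
theorem hom_eq_self_of_killSet {S : Finset Label} {a : Gr} (ha : killSet S a = a)
    {φ : Gr →ₐ[ℂ] Gr} (hφ : ∀ k ∉ S, φ (gen k) = gen k) : φ a = a := by
  have h : φ.comp (killSet S) = killSet S := by
    apply gr_hom_ext
    intro k
    rw [AlgHom.comp_apply, killSet_gen]
    split_ifs with hk
    · exact map_zero φ
    · exact hφ k hk
  rw [← ha, ← AlgHom.comp_apply, h]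

/-! ### Chirality -/

/-- The variables `θ_1, θ_2, θbar_3, θbar_4`. -/
def antiLabels : Finset Label :=
  {Sum.inl (0, 0), Sum.inl (0, 1), Sum.inl (1, 0), Sum.inl (1, 1),
    Sum.inr (2, 0), Sum.inr (2, 1), Sum.inr (3, 0), Sum.inr (3, 1)}

/-- The subalgebra of functions of the chiral and anti-chiral variables. -/
noncomputable def Chi : Subalgebra ℂ Gr := AlgHom.equalizer (killSet antiLabels) (AlgHom.id ℂ Gr)

theorem mem_Chi_iff {a : Gr} : a ∈ Chi ↔ killSet antiLabels a = a := Iff.rfl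

theorem isChiral_iff_mem_Chi {a : Gr} : IsChiral a ↔ a ∈ Chi := by
  rw [mem_Chi_iff, killSet_eq_self_iff]
  have h1 : ∀ i α, DMinus i α a = dGen (Sum.inl (i, α)) a := fun _ _ => rfl
  have h2 : ∀ i α, DBarPlus i α a = -dGen (Sum.inr (i, α)) a := fun _ _ => rfl
  simp only [IsChiral, h1, h2, neg_eq_zero, Fin.forall_fin_two, antiLabels, Finset.mem_insert,
    Finset.mem_singleton, forall_eq_or_imp, forall_eq]
  tauto

/-- Invertibility matters: `Ring.inverse` is `0` on non-units, and a homomorphism may send a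
non-unit to a unit. -/
theorem map_ring_inverse {A B : Type*} [Ring A] [Ring B] (φ : A →+* B) {a : A} (ha : IsUnit a) :
    φ (Ring.inverse a) = Ring.inverse (φ a) := by
  obtain ⟨u, rfl⟩ := ha
  rw [Ring.inverse_unit]
  exact (Ring.inverse_unit (Units.map (φ : A →* B) u)).symm

theorem inverse_mem_Chi {a : Gr} (ha : a ∈ Chi) : Ring.inverse a ∈ Chi := by
  by_cases hu : IsUnit a
  · have h := map_ring_inverse (killSet antiLabels).toRingHom hu
    rw [mem_Chi_iff] at ha ⊢
    exact h.trans (congrArg _ ha)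
  · rw [Ring.inverse_non_unit _ hu]; exact Chi.zero_mem

theorem gen_mem_Chi {k : Label} (hk : k ∉ antiLabels) : gen k ∈ Chi := by
  rw [mem_Chi_iff, killSet_gen, if_neg hk]

/-! ### Bodies and nilpotency -/

/-- The body as a homomorphism. -/
noncomputable def bodyHom : Gr →ₐ[ℂ] ℂ := ExteriorAlgebra.algebraMapInv

theorem bodyHom_apply (a : Gr) : bodyHom a = body a := rfl

theorem bodyHom_ι (v : Label → ℂ) : bodyHom (ι ℂ v) = 0 := by
  rw [bodyHom, ExteriorAlgebra.algebraMapInv, ExteriorAlgebra.lift_ι_apply]; rfl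

theorem bodyHom_Odd {a : Gr} (ha : a ∈ Odd) : bodyHom a = 0 := by
  induction ha using Submodule.span_induction with
  | mem x hx => obtain ⟨v, rfl⟩ := hx; exact bodyHom_ι v
  | zero => exact map_zero _
  | add x y _ _ hx hy => rw [map_add, hx, hy, add_zero]
  | smul r x _ hx => rw [Subalgebra.smul_def, smul_eq_mul, map_mul, hx, mul_zero]

theorem bodyHom_subst (im : Label → Gr) (him : ∀ k, im k ∈ Odd) (a : Gr) :
    bodyHom (subst im him a) = bodyHom a := by
  have h : bodyHom.comp (subst im him) = bodyHom := gr_hom_ext fun k => by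
    rw [AlgHom.comp_apply, subst_gen, bodyHom_Odd (him k), bodyHom_Odd (gen_mem_Odd k)]
  rw [← AlgHom.comp_apply, h]

theorem sub_body_mem_span (a : Gr) :
    a - algebraMap ℂ Gr (bodyHom a) ∈ Submodule.span ℂ {y : Gr | ∃ b v, y = b * ι ℂ v} := by
  induction a using CliffordAlgebra.right_induction with
  | algebraMap r =>
    have : bodyHom (algebraMap ℂ Gr r) = r := bodyHom.commutes r
    erw [this, sub_self]
    exact Submodule.zero_mem _
  | add x y hx hy =>
    rw [map_add, map_add, add_sub_add_comm]; exact Submodule.add_mem _ hx hy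
  | mul_ι v x _ =>
    have h : bodyHom (x * ι ℂ v) = 0 := by rw [map_mul, bodyHom_ι, mul_zero]
    erw [h]
    rw [map_zero, sub_zero]
    exact Submodule.subset_span ⟨x, v, rfl⟩

/-- Each factor `a` supplies one vector on its right end. Centrality moves the new factor past `b`,
so that its vector lands directly in front of the wedge already collected. -/
theorem pow_mem_span {a : Gr} (ha : a ∈ Z) (h0 : bodyHom a = 0) (n : ℕ) :
    a ^ n ∈ Submodule.span ℂ {y : Gr | ∃ (b : Gr) (v : Fin n → Label → ℂ),
      y = b * ExteriorAlgebra.ιMulti ℂ n v} := by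
  induction n with
  | zero =>
    exact Submodule.subset_span ⟨1, Fin.elim0, by simp⟩
  | succ n ih =>
    rw [pow_succ']
    generalize a ^ n = p at ih
    induction ih using Submodule.span_induction with
    | mem y hy =>
      obtain ⟨b, v, rfl⟩ := hy
      rw [← mul_assoc, mem_Z_iff.1 ha]
      have ha' := sub_body_mem_span a
      rw [h0, map_zero, sub_zero] at ha'
      clear ha h0
      induction ha' using Submodule.span_induction with
      | mem z hz =>
        obtain ⟨c, w, rfl⟩ := hz
        refine Submodule.subset_span ⟨b * c, Matrix.vecCons w v, ?_⟩
        rw [ExteriorAlgebra.ιMulti_succ_apply, Matrix.cons_val_zero]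
        simp only [mul_assoc]
        rfl
      | zero => rw [mul_zero, zero_mul]; exact Submodule.zero_mem _
      | add x y _ _ hx hy => rw [mul_add, add_mul]; exact Submodule.add_mem _ hx hy
      | smul c x _ hx =>
        rw [mul_smul_comm, smul_mul_assoc]; exact Submodule.smul_mem _ _ hx
    | zero => rw [mul_zero]; exact Submodule.zero_mem _
    | add x y _ _ hx hy => rw [mul_add]; exact Submodule.add_mem _ hx hy
    | smul c x _ hx => rw [mul_smul_comm]; exact Submodule.smul_mem _ _ hx

/-- Seventeen vectors in a space of dimension sixteen are dependent, so their wedge vanishes. -/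
theorem pow_seventeen_eq_zero {a : Gr} (ha : a ∈ Z) (h0 : bodyHom a = 0) : a ^ 17 = 0 := by
  have h := pow_mem_span ha h0 17
  have hs : {y : Gr | ∃ (b : Gr) (v : Fin 17 → Label → ℂ),
      y = b * ExteriorAlgebra.ιMulti ℂ 17 v} ⊆ {0} := by
    rintro y ⟨b, v, rfl⟩
    rw [AlternatingMap.map_linearDependent, mul_zero]; · rfl
    intro hv
    have := hv.fintype_card_le_finrank
    rw [Module.finrank_fintype_fun_eq_card] at this
    simp at this
  have h' := Submodule.span_mono (R := ℂ) hs h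
  rwa [Submodule.span_zero_singleton, Submodule.mem_bot] at h'

/-! ### Termwise differentiation of Laurent series -/

/-- Bernoulli's inequality for `(β / x) ^ m = (1 + (β - x) / x) ^ m`. -/
theorem natCast_mul_pow_le {m : ℕ} {x β δ : ℝ} (hx : 0 < x) (hδ : δ ≤ β - x) (hδ0 : 0 ≤ δ) :
    (m : ℝ) * δ * x ^ m ≤ x * β ^ m := by
  have h := one_add_mul_le_pow (show -2 ≤ (β - x) / x by
    have := div_nonneg (hδ0.trans hδ) hx.le
    linarith) m
  have e : 1 + (β - x) / x = β / x := by field_simp; ring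
  rw [e, div_pow, le_div_iff₀ (pow_pos hx m)] at h
  have hp := pow_pos hx m
  have h2 : (m : ℝ) * δ ≤ x * (1 + m * ((β - x) / x)) := by
    have : x * (1 + m * ((β - x) / x)) = x + m * (β - x) := by field_simp
    rw [this]
    nlinarith [mul_le_mul_of_nonneg_left hδ (Nat.cast_nonneg (α := ℝ) m)]
  calc (m : ℝ) * δ * x ^ m ≤ x * (1 + m * ((β - x) / x)) * x ^ m :=
        mul_le_mul_of_nonneg_right h2 hp.le
    _ = x * ((1 + m * ((β - x) / x)) * x ^ m) := by ring
    _ ≤ x * β ^ m := mul_le_mul_of_nonneg_left h hx.le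

/-- The outer point `β` controls nonnegative exponents and the inner point `α` negative ones. The
bound does not depend on `x`, so it serves as the majorant for the differentiated series. -/
theorem abs_mul_zpow_sub_one_le {α x β δ : ℝ} (hα : 0 < α) (hδ : 0 < δ) (h₁ : α + δ ≤ x)
    (h₂ : x + δ ≤ β) (n : ℤ) : |(n : ℝ)| * x ^ (n - 1) ≤ (α ^ n + β ^ n) / δ := by
  have hx : 0 < x := by linarith
  have hβ : 0 < β := by linarith
  rw [le_div_iff₀ hδ, zpow_sub_one₀ hx.ne']
  obtain ⟨m, rfl | rfl⟩ := n.eq_nat_or_neg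
  · have h := natCast_mul_pow_le (m := m) hx (by linarith : δ ≤ β - x) hδ.le
    have h' : (m : ℝ) * δ * x ^ m * x⁻¹ ≤ β ^ m := by
      rw [← div_eq_mul_inv, div_le_iff₀ hx]; linarith
    have := pow_pos hα m
    simp only [Int.cast_natCast, Nat.abs_cast, zpow_natCast]
    linarith
  · have h := natCast_mul_pow_le (m := m) hα (by linarith : δ ≤ x - α) hδ.le
    have hxm := pow_pos hx m
    have hαm := pow_pos hα m
    have h' : (m : ℝ) * (x ^ m)⁻¹ * x⁻¹ * δ ≤ (α ^ m)⁻¹ := by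
      have e : (m : ℝ) * (x ^ m)⁻¹ * x⁻¹ * δ = m * δ / (x * x ^ m) := by field_simp
      rw [e, div_le_iff₀ (by positivity), inv_mul_eq_div, le_div_iff₀ hαm]
      exact h.trans (mul_le_mul_of_nonneg_right (by linarith) hxm.le)
    have := inv_pos.2 (pow_pos hβ m)
    simp only [Int.cast_neg, Int.cast_natCast, abs_neg, Nat.abs_cast, zpow_neg, zpow_natCast]
    linarith

/-- A Laurent series that converges unconditionally on an open set may be differentiated there term
by term. -/
theorem hasSum_deriv_of_hasSum_zpow {ι : Type*} {c : ι → ℂ} {n : ι → ℤ} {W : Set ℝ} (hW : IsOpen W)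
    (h0 : (0 : ℝ) ∉ W) {g : ℝ → ℂ} (hg : ∀ t ∈ W, HasSum (fun k => c k * (t : ℂ) ^ n k) (g t))
    {t : ℝ} (ht : t ∈ W) :
    HasSum (fun k => c k * n k * (t : ℂ) ^ (n k - 1)) (deriv g t) := by
  obtain ⟨ε, hε, hball⟩ := Metric.isOpen_iff.1 hW t ht
  have hsub : ∀ y, |y - t| < ε → y ∈ W := fun y hy => hball (by rwa [Metric.mem_ball, Real.dist_eq])
  have htε : ε ≤ |t| := by
    by_contra! h
    exact h0 (hsub 0 (by rwa [zero_sub, abs_neg]))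
  -- The points `t ± 2δ` stay in `W`, keep the sign of `t` because `ε ≤ |t|`, and lie at distance at
  -- least `δ` from the ball of radius `δ` about `t`.
  set δ := ε / 4 with hδ
  have hδ0 : 0 < δ := by positivity
  set u : ι → ℝ := fun k => ‖c k‖ * ((|t - 2 * δ| ^ n k + |t + 2 * δ| ^ n k) / δ) with hu
  have hsum : ∀ y, |y - t| < ε → Summable fun k => ‖c k‖ * |y| ^ n k := by
    intro y hy
    have h := (hg y (hsub y hy)).summable.norm
    simpa [norm_mul, norm_zpow] using h
  have hus : Summable u := by
    have h1 := hsum (t - 2 * δ) (by rw [abs_lt]; constructor <;> linarith)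
    have h2 := hsum (t + 2 * δ) (by rw [abs_lt]; constructor <;> linarith)
    refine ((h1.add h2).div_const δ).congr fun k => ?_
    rw [hu]; ring
  have hbound : ∀ k, ∀ y ∈ Metric.ball t δ, ‖c k * n k * (y : ℂ) ^ (n k - 1)‖ ≤ u k := by
    intro k y hy
    rw [Metric.mem_ball, Real.dist_eq, abs_lt] at hy
    rw [norm_mul, norm_mul, norm_zpow, Complex.norm_real, Complex.norm_intCast, mul_assoc, hu,
      Real.norm_eq_abs]
    refine mul_le_mul_of_nonneg_left ?_ (norm_nonneg _)
    rcases le_total 0 t with h | h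
    · rw [abs_of_nonneg h] at htε
      rw [abs_of_pos (by linarith : 0 < t - 2 * δ), abs_of_pos (by linarith : 0 < t + 2 * δ),
        abs_of_pos (by linarith : 0 < y)]
      exact abs_mul_zpow_sub_one_le (by linarith) hδ0 (by linarith) (by linarith) _
    · rw [abs_of_nonpos h] at htε
      -- On the negative axis `t - 2 * δ` has the larger absolute value, so the inner and outer
      -- points trade places.
      rw [abs_of_neg (by linarith : t - 2 * δ < 0), abs_of_neg (by linarith : t + 2 * δ < 0),
        abs_of_neg (by linarith : y < 0), add_comm]
      exact abs_mul_zpow_sub_one_le (by linarith) hδ0 (by linarith) (by linarith) _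
  have htb : t ∈ Metric.ball t δ := Metric.mem_ball_self hδ0
  have hne : ∀ y ∈ Metric.ball t δ, y ∈ W := fun y hy => by
    rw [Metric.mem_ball, Real.dist_eq] at hy
    exact hsub y (by linarith)
  have hder := hasDerivAt_tsum_of_isPreconnected (𝕜 := ℝ)
    (g := fun k (y : ℝ) => c k * (y : ℂ) ^ n k)
    (g' := fun k (y : ℝ) => c k * n k * (y : ℂ) ^ (n k - 1)) hus Metric.isOpen_ball
    (convex_ball t δ).isPreconnected
    (fun k y hy => by
      have hy0 : (y : ℂ) ≠ 0 := by
        rintro e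
        rw [Complex.ofReal_eq_zero] at e
        exact h0 (e ▸ hne y hy)
      have := ((hasDerivAt_zpow (n k) (y : ℂ) (Or.inl hy0)).comp_ofReal).const_mul (c k)
      rwa [← mul_assoc] at this)
    hbound htb (hg t ht).summable htb
  have heq : g =ᶠ[nhds t] fun z : ℝ => ∑' k, c k * (z : ℂ) ^ n k := by
    filter_upwards [Metric.ball_mem_nhds t hδ0] with y hy
    exact (hg y (hne y hy)).tsum_eq.symm
  rw [(hder.congr_of_eventuallyEq heq).deriv]
  exact (Summable.of_norm_bounded hus fun k => hbound k t htb).hasSum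

theorem succ_mul_choose_succ (k : ℤ) (q : ℕ) :
    ((q : ℤ) + 1) * Ring.choose k (q + 1) = Ring.choose k q * (k - q) := by
  have h := Ring.choose_smul_choose k (Nat.le_succ q)
  rw [Nat.succ_eq_add_one, Nat.choose_succ_self_right,
    Nat.add_sub_cancel_left, Ring.choose_one_right, nsmul_eq_mul] at h
  rw [← h]
  push_cast
  rfl

/-- Dividing by `q!` makes the coefficients integral binomials, the same ones that occur in the
expansion of an integral power. -/
theorem hasSum_iteratedDeriv_of_hasSum_zpow {ι : Type*} {c : ι → ℂ} {n : ι → ℤ} {W : Set ℝ}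
    (hW : IsOpen W) (h0 : (0 : ℝ) ∉ W) {g : ℝ → ℂ}
    (hg : ∀ t ∈ W, HasSum (fun k => c k * (t : ℂ) ^ n k) (g t)) (q : ℕ) :
    ∀ t ∈ W, HasSum (fun k => c k * (Ring.choose (n k) q : ℤ) * (t : ℂ) ^ (n k - q))
      (iteratedDeriv q g t / q.factorial) := by
  induction q with
  | zero => simpa using hg
  | succ q ih =>
    intro t ht
    have h := hasSum_deriv_of_hasSum_zpow hW h0 ih ht
    have h' := h.div_const ((q : ℂ) + 1)
    have hq : (q : ℂ) + 1 ≠ 0 := Nat.cast_add_one_ne_zero q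
    rw [deriv_div_const, ← iteratedDeriv_succ, div_div, mul_comm (q.factorial : ℂ)] at h'
    rw [Nat.factorial_succ]
    push_cast
    refine h'.congr_fun fun k => ?_
    have e := congrArg (Int.cast : ℤ → ℂ) (succ_mul_choose_succ (n k) q)
    push_cast at e
    rw [eq_div_iff hq, sub_sub]
    push_cast
    linear_combination (c k * (t : ℂ) ^ (n k - (q + 1))) * e

/-- Termwise mixed derivatives of a Laurent series in two variables. -/
theorem hasSum_mixedDeriv {a : ℤ × ℤ → ℂ} {f : ℝ → ℝ → ℂ} {V : Set (ℝ × ℝ)} (hV : IsOpen V)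
    (ha : ∀ p ∈ V, p.1 ≠ 0 → p.2 ≠ 0 →
      HasSum (fun k : ℤ × ℤ => a k * (p.1 : ℂ) ^ k.1 * (p.2 : ℂ) ^ k.2) (f p.1 p.2))
    {u v : ℝ} (huv : (u, v) ∈ V) (hu : u ≠ 0) (hv : v ≠ 0) (p q : ℕ) :
    HasSum (fun k : ℤ × ℤ => a k * ((Ring.choose k.1 p : ℤ) * (u : ℂ) ^ (k.1 - p))
        * ((Ring.choose k.2 q : ℤ) * (v : ℂ) ^ (k.2 - q)))
      (mixedDeriv f p q u v / ((p.factorial : ℂ) * (q.factorial : ℂ))) := by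
  have h1 : ∀ s ∈ {s : ℝ | s ≠ 0 ∧ (s, v) ∈ V},
      HasSum (fun k : ℤ × ℤ => a k * ((Ring.choose k.2 q : ℤ) * (v : ℂ) ^ (k.2 - q))
        * (s : ℂ) ^ k.1) (iteratedDeriv q (fun t => f s t) v / q.factorial) := by
    rintro s ⟨hs, hsv⟩
    have hW : IsOpen {t : ℝ | t ≠ 0 ∧ (s, t) ∈ V} :=
      isOpen_ne.inter (hV.preimage (Continuous.prodMk_right s))
    have h := hasSum_iteratedDeriv_of_hasSum_zpow (c := fun k : ℤ × ℤ => a k * (s : ℂ) ^ k.1)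
      (n := fun k => k.2) (g := fun t => f s t) hW (fun h => h.1 rfl)
      (fun t ht => ha (s, t) ht.2 hs ht.1) q v ⟨hv, hsv⟩
    refine h.congr_fun fun k => ?_
    ring
  have hW : IsOpen {s : ℝ | s ≠ 0 ∧ (s, v) ∈ V} :=
    isOpen_ne.inter (hV.preimage (Continuous.prodMk_left v))
  have h := hasSum_iteratedDeriv_of_hasSum_zpow hW (fun h => h.1 rfl) h1 p u ⟨hu, huv⟩
  have e : iteratedDeriv p (fun s => iteratedDeriv q (fun t => f s t) v / (q.factorial : ℂ)) u
      = mixedDeriv f p q u v / q.factorial := by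
    simp only [div_eq_inv_mul, mixedDeriv]
    exact iteratedDeriv_const_mul_field _ _
  rw [e, div_div, mul_comm (q.factorial : ℂ)] at h
  refine h.congr_fun fun k => ?_
  ring

/-! ### Integral powers of Grassmann numbers -/

theorem cst_eq_smul (c : ℂ) : cst c = c • (1 : Gr) := Algebra.algebraMap_eq_smul_one c

/-- The binomial expansion of integral powers. -/
noncomputable def zpowSeries (u : ℂ) (n : Gr) (k : ℤ) : Gr :=
  ∑ p ∈ Finset.range 17, (((Ring.choose k p : ℤ) : ℂ) * u ^ (k - p)) • n ^ p

theorem zpowSeries_zero (u : ℂ) (n : Gr) : zpowSeries u n 0 = 1 := by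
  rw [zpowSeries, Finset.sum_eq_single 0]
  · simp
  · intro p _ hp
    rw [Ring.choose_zero_pos ℤ (Nat.pos_of_ne_zero hp)]; simp
  · simp

/-- Pascal's rule, coefficient by coefficient in the powers of `n`. -/
theorem zpowSeries_succ {u : ℂ} (hu : u ≠ 0) {n : Gr} (hn : n ^ 17 = 0) (k : ℤ) :
    zpowSeries u n (k + 1) = (cst u + n) * zpowSeries u n k := by
  -- The term `p = 16` contains `n ^ 17 = 0`, so the truncation is compatible with multiplication by
  -- `n`.
  have h1 : ∑ p ∈ Finset.range 17, (((Ring.choose k p : ℤ) : ℂ) * u ^ (k - p)) • n ^ (p + 1)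
      = ∑ p ∈ Finset.range 16, (((Ring.choose k p : ℤ) : ℂ) * u ^ (k - p)) • n ^ (p + 1) := by
    rw [Finset.sum_range_succ, hn, smul_zero, add_zero]
  have h2 : n * zpowSeries u n k
      = ∑ p ∈ Finset.range 16, (((Ring.choose k p : ℤ) : ℂ) * u ^ (k - p)) • n ^ (p + 1) := by
    rw [← h1, zpowSeries, Finset.mul_sum]
    exact Finset.sum_congr rfl fun p _ => by rw [mul_smul_comm, pow_succ']
  rw [add_mul, h2, cst_eq_smul, smul_mul_assoc, one_mul, zpowSeries, zpowSeries,
    Finset.sum_range_succ', Finset.sum_range_succ' _ 16, smul_add, Finset.smul_sum,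
    add_right_comm, ← Finset.sum_add_distrib]
  congr 1
  · refine Finset.sum_congr rfl fun p _ => ?_
    rw [smul_smul, ← add_smul, Ring.choose_succ_succ]
    congr 1
    have e : k + 1 - ((p + 1 : ℕ) : ℤ) = k - p := by push_cast; ring
    have e' : u * u ^ (k - ((p + 1 : ℕ) : ℤ)) = u ^ (k - p) := by
      rw [← zpow_one_add₀ hu]; congr 1; push_cast; ring
    rw [e, mul_left_comm, e']
    push_cast
    ring
  · rw [smul_smul]
    simp [zpow_add_one₀ hu, mul_comm]

theorem intPow_unit (w : Grˣ) (k : ℤ) : intPow (w : Gr) k = ((w ^ k : Grˣ) : Gr) := by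
  rw [intPow]
  split_ifs with h
  · obtain ⟨n, rfl⟩ := Int.eq_ofNat_of_zero_le h
    simp
  · obtain ⟨n, rfl⟩ : ∃ n : ℕ, k = -n := ⟨(-k).toNat, by omega⟩
    rw [Ring.inverse_unit, ← Units.val_pow_eq_pow_val]
    simp

/-- Both sides are `1` at `k = 0` and are multiplied by the unit `a` when `k` grows by one, which
determines them in both directions. -/
theorem intPow_eq_zpowSeries {u : ℂ} (hu : u ≠ 0) {a : Gr} (hn : (a - cst u) ^ 17 = 0)
    (ha : IsUnit a) (k : ℤ) : intPow a k = zpowSeries u (a - cst u) k := by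
  obtain ⟨w, rfl⟩ := ha
  have hs : ∀ k, zpowSeries u (w - cst u) (k + 1) = w * zpowSeries u (w - cst u) k := fun k => by
    rw [zpowSeries_succ hu hn, add_sub_cancel]
  rw [intPow_unit]
  induction k using Int.induction_on with
  | zero => rw [zpowSeries_zero, zpow_zero, Units.val_one]
  | succ k ih => rw [hs, ← ih, ← Units.val_mul, ← zpow_one_add, add_comm]
  | pred k ih =>
    have := hs (-k - 1)
    rw [sub_add_cancel, ← ih, ← Units.inv_mul_eq_iff_eq_mul] at this
    rw [← this, ← Units.val_mul, ← zpow_neg_one, ← zpow_add, sub_eq_neg_add]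

/-- A Laurent series, evaluated on Grassmann numbers by the Taylor expansion of its sum, is the sum
of its terms. -/
theorem grHasSum_evalTwo {a : ℤ × ℤ → ℂ} {f : ℝ → ℝ → ℂ} {V : Set (ℝ × ℝ)} (hV : IsOpen V)
    (ha : ∀ p ∈ V, p.1 ≠ 0 → p.2 ≠ 0 →
      HasSum (fun k : ℤ × ℤ => a k * (p.1 : ℂ) ^ k.1 * (p.2 : ℂ) ^ k.2) (f p.1 p.2))
    {u v : ℝ} (huv : (u, v) ∈ V) (hu : u ≠ 0) (hv : v ≠ 0) {A B : Gr}
    (hA : body A = u) (hB : body B = v) (hAn : (A - cst u) ^ 17 = 0) (hBn : (B - cst v) ^ 17 = 0)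
    (hAu : IsUnit A) (hBu : IsUnit B) :
    GrHasSum (fun k : ℤ × ℤ => a k • (intPow A k.1 * intPow B k.2)) (evalTwo f A B) := by
  intro φ
  rw [evalTwo, map_sum]
  simp_rw [map_sum, hA, hB, Complex.ofReal_re, map_smul, smul_eq_mul]
  have h := hasSum_sum (s := Finset.range 17) fun p _ => hasSum_sum (s := Finset.range 17)
    fun q _ => (hasSum_mixedDeriv hV ha huv hu hv p q).mul_right
      (φ ((A - cst u) ^ p * (B - cst v) ^ q))
  refine h.congr_fun fun k => ?_
  rw [intPow_eq_zpowSeries (Complex.ofReal_ne_zero.2 hu) hAn hAu,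
    intPow_eq_zpowSeries (Complex.ofReal_ne_zero.2 hv) hBn hBu, zpowSeries, zpowSeries,
    Finset.sum_mul_sum, map_sum, Finset.mul_sum]
  refine Finset.sum_congr rfl fun p _ => ?_
  rw [map_sum, Finset.mul_sum]
  refine Finset.sum_congr rfl fun q _ => ?_
  rw [smul_mul_smul_comm, map_smul, smul_eq_mul]
  ring

end SuperFourPoint

/-! ### Two by two matrices of products of anticommuting quantities -/

/-- The matrix entries behave as products `t_α b_β` of anticommuting quantities. -/
structure IsOddProduct {R : Type*} [CommRing R] (M : Matrix (Fin 2) (Fin 2) R) : Prop where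
  row (i j k : Fin 2) : M i j * M i k = 0
  col (i j k : Fin 2) : M j i * M k i = 0
  cross : M 0 0 * M 1 1 = -(M 0 1 * M 1 0)

namespace IsOddProduct

open Matrix

variable {R : Type*} [CommRing R] {M : Matrix (Fin 2) (Fin 2) R}

/-- Among three entries of `M` two lie in the same row, and their product vanishes. -/
theorem trace_pow_three (h : IsOddProduct M) (P : Matrix (Fin 2) (Fin 2) R) :
    (P * M).trace ^ 3 = 0 := by
  have r1 := h.row 0 0 0
  have r2 := h.row 0 0 1
  have r3 := h.row 0 1 1
  have r4 := h.row 1 0 0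
  have r5 := h.row 1 0 1
  have r6 := h.row 1 1 1
  have c2 := h.col 0 0 1
  have c5 := h.col 1 0 1
  have x := h.cross
  simp only [trace_fin_two, mul_apply, Fin.sum_univ_two]
  grobner

/-- For commuting factors `P * M` would have rank one and determinant zero. The sign in `cross`
makes the determinant the square of the trace instead. As the trace has vanishing cube, the right
side is the inverse of `1 - tr (P * M)`. -/
theorem det_one_add (h : IsOddProduct M) (P : Matrix (Fin 2) (Fin 2) R) :
    (1 + P * M).det = 1 + (P * M).trace + (P * M).trace ^ 2 := by
  have r1 := h.row 0 0 0
  have r2 := h.row 0 0 1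
  have r3 := h.row 0 1 1
  have r4 := h.row 1 0 0
  have r5 := h.row 1 0 1
  have r6 := h.row 1 1 1
  have c2 := h.col 0 0 1
  have c5 := h.col 1 0 1
  have x := h.cross
  simp only [trace_fin_two, det_fin_two, Matrix.add_apply, mul_apply, Fin.sum_univ_two,
    one_apply_eq, one_apply_ne (show (0 : Fin 2) ≠ 1 by decide),
    one_apply_ne (show (1 : Fin 2) ≠ 0 by decide), zero_add]
  grobner

/-- The cross ratio of the matrices that arise after the substitution annihilating all nilpotent
invariants. -/
theorem cross_ratio [Algebra ℂ R] (h : IsOddProduct M) (k : ℂ)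
    {a b c d e : Matrix (Fin 2) (Fin 2) R} (hd : IsUnit d.det) (he : IsUnit e.det)
    (hg : IsUnit (a - c).det) :
    c.det * (-(b * e⁻¹ * d)).det * Ring.inverse (d.det * (-(a - c) + k • (a * e⁻¹ * M)).det)
      = (1 + k • ((a - c)⁻¹ * (a * e⁻¹) * M).trace)
        * (c.det * b.det * Ring.inverse (e.det * (a - c).det)) := by
  set g := a - c with hgdef
  set t := (g⁻¹ * (a * e⁻¹) * M).trace with ht
  have hneg : ∀ A : Matrix (Fin 2) (Fin 2) R, (-A).det = A.det := fun A => by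
    rw [det_neg]; simp
  have h3 : t ^ 3 = 0 := h.trace_pow_three _
  have hdet : (-g + k • (a * e⁻¹ * M)).det = g.det * (1 - k • t + (k • t) ^ 2) := by
    have e1 : -g + k • (a * e⁻¹ * M) = -(g * (1 + ((-k) • (g⁻¹ * (a * e⁻¹))) * M)) := by
      rw [mul_add, mul_one, smul_mul_assoc, mul_smul_comm, ← mul_assoc g, ← mul_assoc g,
        mul_nonsing_inv g hg, one_mul, neg_add, neg_smul, neg_neg]
    rw [e1, hneg, det_mul, h.det_one_add, smul_mul_assoc, trace_smul, ← ht, neg_smul]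
    ring
  -- The product is `1 + (k • t) ^ 3`.
  have hinv : (1 + k • t) * (1 - k • t + (k • t) ^ 2) = 1 := by
    have : (k • t) ^ 3 = 0 := by rw [smul_pow, h3, smul_zero]
    linear_combination this
  have hu : IsUnit (1 - k • t + (k • t) ^ 2) :=
    IsUnit.of_mul_eq_one _ ((mul_comm _ _).trans hinv)
  have he' : e⁻¹.det * e.det = 1 := by rw [← det_mul, nonsing_inv_mul e he, det_one]
  have hLu : IsUnit (d.det * (-g + k • (a * e⁻¹ * M)).det) := by
    rw [hdet]; exact hd.mul (hg.mul hu)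
  have hRu : IsUnit (e.det * g.det) := he.mul hg
  rw [hneg, det_mul, det_mul]
  apply hLu.mul_right_cancel
  rw [mul_assoc, Ring.inverse_mul_cancel _ hLu, hdet]
  have hR := Ring.inverse_mul_cancel _ hRu
  set r := Ring.inverse (e.det * g.det)
  apply hRu.mul_right_cancel
  linear_combination (c.det * b.det * d.det * g.det) * he'
    - (c.det * b.det * d.det * g.det) * hinv
    - (c.det * b.det * d.det * g.det * (1 + k • t) * (1 - k • t + (k • t) ^ 2)) * hR

/-- The nilpotent quantity as a trace. -/
theorem trace_expand (M : Matrix (Fin 2) (Fin 2) R) (a b c : Matrix (Fin 2) (Fin 2) R) :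
    ((a - c).adjugate * (a * (a - b).adjugate) * M).trace
      = (c.adjugate * a * b.adjugate * M).trace
        - a.det * ((b.adjugate * M).trace + (c.adjugate * M).trace - (a.adjugate * M).trace) := by
  simp only [trace_fin_two, det_fin_two, adjugate_fin_two, mul_apply, Fin.sum_univ_two,
    Matrix.sub_apply, of_apply, cons_val', cons_val_zero, cons_val_one, cons_val_fin_one]
  ring

end IsOddProduct

namespace SuperFourPoint

/-! ### The centre as a commutative ring -/

/-- A nonzero constant plus a nilpotent element is invertible. -/
theorem isUnit_Z {z : Z} (hz : bodyHom z ≠ 0) : IsUnit z := by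
  set c := bodyHom z with hc
  have hm : (z : Gr) - algebraMap ℂ Gr c ∈ Z := Z.sub_mem z.2 (Z.algebraMap_mem c)
  have hn : ((z : Gr) - algebraMap ℂ Gr c) ^ 17 = 0 :=
    pow_seventeen_eq_zero hm (by rw [map_sub, AlgHom.commutes, ← hc]; exact sub_self c)
  have hn' : IsNilpotent (z - algebraMap ℂ Z c) := ⟨17, Subtype.ext hn⟩
  have hu : IsUnit (algebraMap ℂ Z c) := (IsUnit.mk0 c hz).map _
  have := hn'.isUnit_add_left_of_commute hu (Commute.all _ _)
  rwa [add_sub_cancel] at this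

theorem coe_inverse {z : Z} (hz : bodyHom z ≠ 0) :
    ((Ring.inverse z : Z) : Gr) = Ring.inverse (z : Gr) :=
  map_ring_inverse (Z.val : Z →+* Gr) (isUnit_Z hz)

theorem isUnit_of_mem_Z {a : Gr} (ha : a ∈ Z) (h : bodyHom a ≠ 0) : IsUnit a :=
  (isUnit_Z (z := ⟨a, ha⟩) h).map Z.val

/-- A matrix over the centre as a matrix of Grassmann numbers. -/
noncomputable def matCoe (A : Matrix (Fin 2) (Fin 2) Z) : Matrix (Fin 2) (Fin 2) Gr :=
  A.map Z.val

theorem matCoe_mul (A B : Matrix (Fin 2) (Fin 2) Z) : matCoe (A * B) = matCoe A * matCoe B :=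
  Matrix.map_mul (f := (Z.val : Z →+* Gr))

/-- The matrix `v_μ σ^μ` of a vector with components in the centre. -/
noncomputable def tm (v : Fin 4 → Z) : Matrix (Fin 2) (Fin 2) Z :=
  !![v 0 + v 3, v 1 - Complex.I • v 2; v 1 + Complex.I • v 2, v 0 - v 3]

theorem tm_add (v w : Fin 4 → Z) : tm (v + w) = tm v + tm w := by
  ext i j
  fin_cases i <;> fin_cases j <;> simp [tm] <;> module

theorem tm_smul (c : ℂ) (v : Fin 4 → Z) : tm (c • v) = c • tm v := by
  ext i j
  fin_cases i <;> fin_cases j <;> simp [tm] <;> module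

theorem tm_neg (v : Fin 4 → Z) : tm (-v) = -tm v := by
  rw [← neg_one_smul ℂ v, tm_smul, neg_one_smul]

theorem tm_sub (v w : Fin 4 → Z) : tm (v - w) = tm v - tm w := by
  rw [sub_eq_add_neg, tm_add, tm_neg, sub_eq_add_neg]

theorem slashTilde_coe (v : Fin 4 → Z) : slashTilde (fun μ => (v μ : Gr)) = matCoe (tm v) := by
  ext i j
  fin_cases i <;> fin_cases j <;>
    simp [slashTilde, sigmaTilde, sigma, metric, tm, matCoe, Fin.sum_univ_four, sub_eq_add_neg]

/-- Reversing the spatial components of a 2 × 2 matrix in the Pauli basis is taking its adjugate.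
With `sq_coe` this makes `xtilde_{ibar j}^{-1}` the genuine inverse of the matrix `xtilde_{ibar j}`.
-/
theorem slash_coe (v : Fin 4 → Z) : slash (fun μ => (v μ : Gr)) = matCoe (tm v).adjugate := by
  ext i j
  fin_cases i <;> fin_cases j <;>
    simp [slash, sigma, metric, tm, matCoe, Fin.sum_univ_four, Matrix.adjugate_fin_two] <;>
    module

theorem sq_coe (v : Fin 4 → Z) : sq (fun μ => (v μ : Gr)) = ((tm v).det : Z) := by
  have h : (tm v).det = v 0 * v 0 - v 1 * v 1 - v 2 * v 2 - v 3 * v 3 := by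
    have hI : (Complex.I • v 2) * (Complex.I • v 2) = -(v 2 * v 2) := by
      rw [smul_mul_smul_comm, Complex.I_mul_I, neg_one_smul]
    rw [Matrix.det_fin_two, tm]
    simp only [Matrix.of_apply, Matrix.cons_val', Matrix.cons_val_zero, Matrix.cons_val_one,
      Matrix.cons_val_fin_one]
    generalize Complex.I • v 2 = w at hI ⊢
    linear_combination hI
  rw [h]
  simp [sq, metric, Fin.sum_univ_four, sub_eq_add_neg]

/-! ### Odd spinors -/

/-- Spinors with odd components. -/
abbrev Spinor : Type := Fin 2 → Odd

/-- The action of matrices over the centre on odd spinors. -/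
noncomputable def act (K : Matrix (Fin 2) (Fin 2) Z) (b : Spinor) : Spinor :=
  fun β => ∑ γ, K β γ • b γ

theorem coe_act (K : Matrix (Fin 2) (Fin 2) Z) (b : Spinor) :
    (fun β => (act K b β : Gr)) = (matCoe K).mulVec (fun β => (b β : Gr)) := by
  ext β
  simp [act, Matrix.mulVec, dotProduct, matCoe, Subalgebra.smul_def]

theorem act_act (K L : Matrix (Fin 2) (Fin 2) Z) (b : Spinor) : act K (act L b) = act (K * L) b := by
  ext β
  simp only [act, Matrix.mul_apply, Finset.smul_sum, Finset.sum_smul, smul_smul]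
  rw [Finset.sum_comm]

/-- The even matrix `t_α b_β`, in the position `βα`. -/
noncomputable def pairM (t b : Spinor) : Matrix (Fin 2) (Fin 2) Z :=
  fun β α => ⟨t α * b β, Odd_mul_mem_Z (t α).2 (b β).2⟩

theorem pairM_add_right (t b b' : Spinor) : pairM t (b + b') = pairM t b + pairM t b' := by
  ext β α; simp [pairM, mul_add]

theorem pairM_sub_left (t t' b : Spinor) : pairM (t - t') b = pairM t b - pairM t' b := by
  ext β α; simp [pairM, sub_mul]

theorem pairM_sub_right (t b b' : Spinor) : pairM t (b - b') = pairM t b - pairM t b' := by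
  ext β α; simp [pairM, mul_sub]

theorem pairM_act (t b : Spinor) (K : Matrix (Fin 2) (Fin 2) Z) :
    pairM t (act K b) = K * pairM t b := by
  ext β α
  have h : ∀ γ, (t α : Gr) * ((K β γ : Gr) * b γ) = K β γ * (t α * b γ) := fun γ => by
    rw [← mul_assoc, ← mem_Z_iff.1 (K β γ).2, mul_assoc]
  simp [pairM, act, Matrix.mul_apply, Subalgebra.smul_def, mul_add, h]

theorem isOddProduct_pairM (t b : Spinor) : IsOddProduct (pairM t b) := by
  have hswap : ∀ α β γ δ : Fin 2, (t α : Gr) * b β * (t γ * b δ) = -(t α * t γ * (b β * b δ)) := by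
    intro α β γ δ
    rw [mul_assoc, ← mul_assoc (b β : Gr), Odd_mul_comm_neg (b β).2 (t γ).2]
    simp only [mul_assoc, neg_mul, mul_neg]
  refine ⟨fun i j k => Subtype.ext ?_, fun i j k => Subtype.ext ?_, Subtype.ext ?_⟩
  · change (t j : Gr) * b i * (t k * b i) = 0
    rw [hswap, Odd_mul_self (b i).2, mul_zero, neg_zero]
  · change (t i : Gr) * b j * (t i * b k) = 0
    rw [hswap, Odd_mul_self (t i).2, zero_mul, neg_zero]
  · change (t 0 : Gr) * b 0 * (t 1 * b 1) = -(t 1 * b 0 * (t 0 * b 1))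
    rw [hswap, hswap, Odd_mul_comm_neg (t 1).2 (t 0).2, neg_mul, neg_neg]

theorem sandwich_coe (t b : Spinor) (K : Matrix (Fin 2) (Fin 2) Z) :
    sandwich (fun α => (t α : Gr)) (matCoe K) (fun β => (b β : Gr))
      = ((K * pairM t b).trace : Z) := by
  have h : ∀ α β, (t α : Gr) * K α β * b β = K α β * (t α * b β) := fun α β => by
    rw [← mem_Z_iff.1 (K α β).2, mul_assoc]
  simp [sandwich, matCoe, Matrix.trace_fin_two, Matrix.mul_apply, pairM, h]

/-- The vector `t σ^μ b`. -/
noncomputable def bilinZ (t b : Spinor) : Fin 4 → Z :=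
  fun μ => ∑ α, ∑ β, sigma μ α β • pairM t b β α

theorem coe_bilinZ (t b : Spinor) (μ : Fin 4) :
    (bilinZ t b μ : Gr) = bilin (fun α => (t α : Gr)) (fun β => (b β : Gr)) μ := by
  simp [bilinZ, bilin, pairM]

/-- The completeness (Fierz) relation of the matrices `σ^μ`; it turns the factors `2i` of the
intervals into `4i` in `tW_eq`. -/
theorem tm_bilinZ (t b : Spinor) : tm (bilinZ t b) = (2 : ℂ) • pairM t b := by
  ext i j
  fin_cases i <;> fin_cases j <;>
    simp [tm, bilinZ, sigma, two_smul, smul_smul] <;> module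

/-! ### Intervals after a substitution for the Grassmann spinors -/

/-- The odd spinor `θ_i`. -/
noncomputable def thetaO (i : Fin 4) : Spinor := fun α => ⟨theta i α, gen_mem_Odd (Sum.inl (i, α))⟩

/-- The odd spinor `θbar_i`. -/
noncomputable def thetaBarO (i : Fin 4) : Spinor :=
  fun β => ⟨thetaBar i β, gen_mem_Odd (Sum.inr (i, β))⟩

/-- The substitution `θ_i ↦ τ_i`, `θbar_i ↦ τb_i`. -/
noncomputable def substS (τ τb : Fin 4 → Spinor) : Gr →ₐ[ℂ] Gr :=
  subst (Sum.elim (fun p => (τ p.1 p.2 : Gr)) (fun p => (τb p.1 p.2 : Gr)))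
    (by rintro (p | p); exacts [(τ p.1 p.2).2, (τb p.1 p.2).2])

section

variable (τ τb : Fin 4 → Spinor) (x : Config)

theorem substS_theta (i : Fin 4) (α : Fin 2) : substS τ τb (theta i α) = τ i α :=
  subst_gen _ _ (Sum.inl (i, α))

theorem substS_thetaBar (i : Fin 4) (α : Fin 2) : substS τ τb (thetaBar i α) = τb i α :=
  subst_gen _ _ (Sum.inr (i, α))

theorem substS_thetaO : substS thetaO thetaBarO = AlgHom.id ℂ Gr := by
  apply gr_hom_ext
  rintro (k | k)
  · exact substS_theta _ _ _ _
  · exact substS_thetaBar _ _ _ _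

theorem bodyHom_substS (a : Gr) : bodyHom (substS τ τb a) = bodyHom a := bodyHom_subst _ _ a

theorem substS_bilin (i j μ : Fin 4) :
    substS τ τb (bilin (theta i) (thetaBar j) μ) = bilinZ (τ i) (τb j) μ := by
  simp [bilin, coe_bilinZ, substS_theta, substS_thetaBar]

/-- The even coordinates of a point. -/
noncomputable def xConst (i : Fin 4) : Fin 4 → Z := fun μ => algebraMap ℂ Z (x i μ)

/-- The interval `x_{ibar j}` with the spinors `τ`, `τb` in place of `θ`, `θbar`. -/
noncomputable def xiW (i j : Fin 4) : Fin 4 → Z :=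
  (if i = 0 ∨ i = 1 then xConst x i
    else xConst x i + (2 * Complex.I) • bilinZ (τ i) (τb i))
  - (if j = 0 ∨ j = 1 then xConst x j - (2 * Complex.I) • bilinZ (τ j) (τb j)
    else xConst x j)
  - (2 * Complex.I) • bilinZ (τ j) (τb i)

/-- The matrix of the interval `x_{ibar j}` with the spinors `τ`, `τb` in place of `θ`, `θbar`. -/
noncomputable def tW (i j : Fin 4) : Matrix (Fin 2) (Fin 2) Z := tm (xiW τ τb x i j)

theorem substS_xi (i j μ : Fin 4) : substS τ τb (xi x i j μ) = xiW τ τb x i j μ := by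
  have hc : ∀ c : ℂ, substS τ τb (cst c) = algebraMap ℂ Gr c := fun c => AlgHom.commutes _ c
  unfold xi xMinus xPlus xiW
  split_ifs <;> simp [substS_bilin, hc, xConst]

theorem substS_xi_fun (i j : Fin 4) :
    (fun μ => substS τ τb (xi x i j μ)) = fun μ => (xiW τ τb x i j μ : Gr) :=
  funext fun μ => substS_xi τ τb x i j μ

theorem substS_sq (v : Fin 4 → Gr) : substS τ τb (sq v) = sq fun μ => substS τ τb (v μ) := by
  simp only [sq, map_sum, map_smul, map_mul]

theorem substS_xiSq (i j : Fin 4) : substS τ τb (xiSq x i j) = ((tW τ τb x i j).det : Z) := by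
  rw [xiSq, substS_sq, substS_xi_fun, sq_coe, tW]

theorem substS_xm (i j : Fin 4) (α β : Fin 2) :
    substS τ τb (xm x i j α β) = matCoe (tW τ τb x i j).adjugate α β := by
  rw [tW, ← slash_coe, ← substS_xi_fun]
  simp [xm, slash]

theorem substS_xt (i j : Fin 4) (α β : Fin 2) :
    substS τ τb (xt x i j α β) = matCoe (tW τ τb x i j) α β := by
  rw [tW, ← slashTilde_coe, ← substS_xi_fun]
  simp [xt, slashTilde]

theorem bodyHom_bilin (t b : Spinor) (μ : Fin 4) : bodyHom (bilinZ t b μ) = 0 := by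
  simp [coe_bilinZ, bilin, bodyHom_Odd (t _).2]

theorem bodyHom_xi (i j μ : Fin 4) : bodyHom (xi x i j μ) = (x i μ - x j μ : ℝ) := by
  have hc : ∀ c : ℂ, bodyHom (algebraMap ℂ Gr c) = c := fun c => AlgHom.commutes _ c
  rw [← bodyHom_substS thetaO thetaBarO, substS_xi]
  unfold xiW
  split_ifs <;> simp [bodyHom_bilin, xConst, hc]

theorem bodyHom_sq (v : Fin 4 → Gr) : bodyHom (sq v) = ∑ μ, (metric μ : ℂ) * bodyHom (v μ) ^ 2 := by
  simp only [sq, map_sum, map_smul, map_mul, smul_eq_mul, pow_two]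

theorem bodyHom_xiSq (i j : Fin 4) : bodyHom (xiSq x i j) = mink x i j := by
  rw [xiSq, bodyHom_sq, mink]
  push_cast
  exact Finset.sum_congr rfl fun μ _ => by rw [bodyHom_xi]; push_cast; rfl

theorem bodyHom_det_tW (i j : Fin 4) : bodyHom ((tW τ τb x i j).det : Z) = mink x i j := by
  rw [← substS_xiSq, bodyHom_substS, bodyHom_xiSq]

theorem isUnit_det_tW {i j : Fin 4} (h : mink x i j ≠ 0) : IsUnit (tW τ τb x i j).det :=
  isUnit_Z (by rw [bodyHom_det_tW]; exact_mod_cast h)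

theorem xi_eq (i j μ : Fin 4) : xi x i j μ = xiW thetaO thetaBarO x i j μ := by
  rw [← substS_xi, substS_thetaO]; rfl

theorem xiSq_eq (i j : Fin 4) : xiSq x i j = ((tW thetaO thetaBarO x i j).det : Z) := by
  rw [← substS_xiSq, substS_thetaO]; rfl

theorem xm_eq (i j : Fin 4) : xm x i j = matCoe (tW thetaO thetaBarO x i j).adjugate := by
  ext α β
  rw [← substS_xm, substS_thetaO]; rfl

theorem xt_eq (i j : Fin 4) : xt x i j = matCoe (tW thetaO thetaBarO x i j) := by
  ext α β
  rw [← substS_xt, substS_thetaO]; rfl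

theorem isUnit_xiSq {i j : Fin 4} (h : mink x i j ≠ 0) : IsUnit (xiSq x i j) := by
  rw [xiSq_eq]
  exact (isUnit_det_tW thetaO thetaBarO x h).map Z.val

theorem substS_inverse {a : Gr} (ha : IsUnit a) :
    substS τ τb (Ring.inverse a) = Ring.inverse (substS τ τb a) :=
  map_ring_inverse (substS τ τb : Gr →+* Gr) ha

theorem substS_xtInv_mulVec {i j : Fin 4} (h : mink x i j ≠ 0) (α : Fin 2) :
    substS τ τb ((xtInv x i j).mulVec (thetaBarD i j) α)
      = (act (tW τ τb x i j)⁻¹ (τb i - τb j) α : Gr) := by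
  have hb : bodyHom ((tW τ τb x i j).det : Z) ≠ 0 := by
    rw [bodyHom_det_tW]; exact_mod_cast h
  have hd : ∀ β, substS τ τb (thetaBarD i j β) = ((τb i - τb j) β : Gr) := fun β => by
    simp [thetaBarD, substS_thetaBar]
  have he : ∀ β, substS τ τb (xtInv x i j α β) = matCoe (tW τ τb x i j)⁻¹ α β := fun β => by
    rw [xtInv, Matrix.smul_apply, smul_eq_mul, map_mul, substS_xm,
      substS_inverse _ _ (isUnit_xiSq x h), substS_xiSq, ← coe_inverse hb, Matrix.inv_def]
    simp [matCoe]
  rw [congrFun (coe_act _ _) α]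
  simp only [Matrix.mulVec, dotProduct, map_sum, map_mul, hd, he]

theorem tW_eq (i j : Fin 4) : tW τ τb x i j =
    (if i = 0 ∨ i = 1 then tm (xConst x i)
      else tm (xConst x i) + (4 * Complex.I) • pairM (τ i) (τb i))
    - (if j = 0 ∨ j = 1 then tm (xConst x j) - (4 * Complex.I) • pairM (τ j) (τb j)
      else tm (xConst x j))
    - (4 * Complex.I) • pairM (τ j) (τb i) := by
  have h : ∀ t b, (2 * Complex.I) • (2 : ℂ) • pairM t b = (4 * Complex.I) • pairM t b :=
    fun t b => by rw [smul_smul]; ring_nf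
  unfold tW xiW
  split_ifs <;> simp only [tm_sub, tm_add, tm_smul, tm_bilinZ, h]

end

/-! ### The substitution annihilating the nilpotent invariants -/

section

variable (x : Config)

/-- The matrix `xtilde_{ibar j}` over the centre. -/
noncomputable abbrev tX (i j : Fin 4) : Matrix (Fin 2) (Fin 2) Z := tW thetaO thetaBarO x i j

/-- `θ_1` and `θ_2` are replaced by `θ_4`. -/
noncomputable def newTheta : Fin 4 → Spinor := ![thetaO 3, thetaO 3, thetaO 2, thetaO 3]

/-- `θbar_3` and `θbar_4` are replaced by combinations of `θbar_1` and `θbar_2`. -/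
noncomputable def newThetaBar : Fin 4 → Spinor :=
  ![thetaBarO 0, thetaBarO 1,
    thetaBarO 0 + act (tX x 0 2 * (tX x 0 2 - tX x 1 2)⁻¹) (thetaBarO 1 - thetaBarO 0),
    thetaBarO 0 + act (tX x 0 3 * (tX x 0 3 - tX x 1 3)⁻¹) (thetaBarO 1 - thetaBarO 0)]

/-- The substitution under which all nilpotent invariants vanish. -/
noncomputable def phi : Gr →ₐ[ℂ] Gr := substS newTheta (newThetaBar x)

/-- The products of the components of `θ_34` and `θbar_21`. -/
noncomputable def oddM : Matrix (Fin 2) (Fin 2) Z :=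
  pairM (thetaO 2 - thetaO 3) (thetaBarO 1 - thetaBarO 0)

theorem phi_eq_self {a : Gr} (ha : a ∈ Chi) : phi x a = a := by
  refine hom_eq_self_of_killSet (mem_Chi_iff.1 ha) fun k hk => ?_
  rcases k with ⟨i, α⟩ | ⟨i, α⟩
  · refine (substS_theta _ _ i α).trans ?_
    fin_cases i
    · exact absurd (by fin_cases α <;> decide) hk
    · exact absurd (by fin_cases α <;> decide) hk
    · rfl
    · rfl
  · refine (substS_thetaBar _ _ i α).trans ?_
    fin_cases i
    · rfl
    · rfl
    · exact absurd (by fin_cases α <;> decide) hk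
    · exact absurd (by fin_cases α <;> decide) hk

/-- The bosonic coordinates of the second point cancel in each difference, leaving only the change
from `θ_3` to `θ_4` in the bilinear terms. -/
theorem tX_sub_eq : tX x 0 3 - tX x 1 3
    = tX x 0 2 - tX x 1 2 - (4 * Complex.I) • oddM := by
  simp only [tX, tW_eq, oddM, pairM_sub_left, pairM_sub_right]
  simp
  module

/-- The matrices of the intervals after the substitution. -/
noncomputable abbrev tN (i j : Fin 4) : Matrix (Fin 2) (Fin 2) Z := tW newTheta (newThetaBar x) x i j

/-- As `θ_1` becomes `θ_4`, the image of `θbar_4` drops out, so its replacement can be chosen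
afterwards. -/
theorem tN_three_zero : tN x 3 0 = -tX x 0 3 := by
  simp only [tN, tX, tW_eq]
  simp [newTheta, newThetaBar, pairM_add_right]
  module

theorem tN_one_zero : tN x 1 0 = -(tX x 0 3 - tX x 1 3) := by
  simp only [tN, tX, tW_eq]
  simp [newTheta, newThetaBar]
  module

theorem tN_zero_one : tN x 0 1 = tX x 0 3 - tX x 1 3 := by
  simp only [tN, tX, tW_eq]
  simp [newTheta, newThetaBar]
  module

/-- The replacement of `θbar_31`. -/
noncomputable def rho : Spinor :=
  act (tX x 0 2 * (tX x 0 2 - tX x 1 2)⁻¹) (thetaBarO 1 - thetaBarO 0)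

theorem newThetaBar_two : newThetaBar x 2 = thetaBarO 0 + rho x := rfl

theorem pairM_rho :
    pairM (thetaO 2 - thetaO 3) (rho x) = tX x 0 2 * (tX x 0 2 - tX x 1 2)⁻¹ * oddM :=
  pairM_act _ _ _

theorem tN_two_zero_eq_add : tN x 2 0
    = -tX x 0 2 + (4 * Complex.I) • (tX x 0 2 * (tX x 0 2 - tX x 1 2)⁻¹ * oddM) := by
  rw [← pairM_rho]
  simp only [tN, tX, tW_eq, newThetaBar_two, pairM_add_right, pairM_sub_left]
  simp [newTheta, newThetaBar]
  module

theorem tN_two_three : tN x 2 3 = -(tX x 0 2 - tX x 0 3)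
    + (4 * Complex.I) • (tX x 0 2 * (tX x 0 2 - tX x 1 2)⁻¹ * oddM) := by
  rw [← pairM_rho]
  simp only [tN, tX, tW_eq, newThetaBar_two, pairM_add_right, pairM_sub_left]
  simp [newTheta]
  module

theorem tN_two_one_eq_add : tN x 2 1 = -tX x 1 2
    + (4 * Complex.I) • (tX x 0 2 * (tX x 0 2 - tX x 1 2)⁻¹ * oddM - oddM) := by
  rw [← pairM_rho, oddM]
  simp only [tN, tX, tW_eq, newThetaBar_two, pairM_add_right, pairM_sub_left, pairM_sub_right]
  simp [newTheta, newThetaBar]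
  module

variable {x}

theorem mul_inv_cancel_of_isUnit {e : Matrix (Fin 2) (Fin 2) Z} (he : IsUnit e.det)
    (a : Matrix (Fin 2) (Fin 2) Z) : a * e⁻¹ * e = a := by
  rw [mul_assoc, Matrix.nonsing_inv_mul e he, mul_one]

/-- This fixes the replacement of `θbar_3`. Write `θbar_31 = K θbar_21`, `a = tX x 0 2`, `e = a - tX
x 1 2` and `d = tX x 0 3 - tX x 1 3 = e - 4i M`. The interval is then `-a + 4i K M`, which equals
`-K d` exactly when `a = K e`. -/
theorem tN_two_zero (he : IsUnit (tX x 0 2 - tX x 1 2).det) : tN x 2 0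
    = -(tX x 0 2 * (tX x 0 2 - tX x 1 2)⁻¹ * (tX x 0 3 - tX x 1 3)) := by
  rw [tN_two_zero_eq_add, tX_sub_eq, mul_sub, mul_inv_cancel_of_isUnit he, mul_smul_comm]
  abel

theorem tN_two_one (he : IsUnit (tX x 0 2 - tX x 1 2).det) : tN x 2 1
    = -(tX x 1 2 * (tX x 0 2 - tX x 1 2)⁻¹ * (tX x 0 3 - tX x 1 3)) := by
  have h : tX x 0 2 * (tX x 0 2 - tX x 1 2)⁻¹
      = 1 + tX x 1 2 * (tX x 0 2 - tX x 1 2)⁻¹ := by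
    rw [← Matrix.mul_nonsing_inv _ he, ← add_mul, sub_add_cancel]
  rw [tN_two_one_eq_add, tX_sub_eq, mul_sub, mul_inv_cancel_of_isUnit he, mul_smul_comm, h,
    add_mul, one_mul, add_sub_cancel_left]
  abel

theorem bodyHom_det_tX_sub (i j i' j' : Fin 4) :
    bodyHom ((tX x i j - tX x i' j').det : Z)
      = ∑ μ, (metric μ : ℂ) * ((x i μ - x j μ : ℝ) - (x i' μ - x j' μ : ℝ) : ℂ) ^ 2 := by
  rw [tX, tX, tW, tW, ← tm_sub, ← sq_coe, bodyHom_sq]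
  refine Finset.sum_congr rfl fun μ _ => ?_
  rw [Pi.sub_apply, Subalgebra.coe_sub, map_sub, ← xi_eq, ← xi_eq, bodyHom_xi, bodyHom_xi]

theorem mink_comm (i j : Fin 4) : mink x i j = mink x j i := by
  simp only [mink, sub_sq_comm]

theorem bodyHom_e : bodyHom ((tX x 0 2 - tX x 1 2).det : Z) = mink x 0 1 := by
  rw [bodyHom_det_tX_sub, mink]; push_cast
  exact Finset.sum_congr rfl fun μ _ => by ring

theorem bodyHom_d : bodyHom ((tX x 0 3 - tX x 1 3).det : Z) = mink x 0 1 := by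
  rw [bodyHom_det_tX_sub, mink]; push_cast
  exact Finset.sum_congr rfl fun μ _ => by ring

theorem bodyHom_g : bodyHom ((tX x 0 2 - tX x 0 3).det : Z) = mink x 2 3 := by
  rw [bodyHom_det_tX_sub, mink]; push_cast
  exact Finset.sum_congr rfl fun μ _ => by ring

end

/-- The separations of the four points are not lightlike. -/
def Separated (x : Config) : Prop := ∀ i j : Fin 4, i ≠ j → mink x i j ≠ 0

section

variable {x : Config}

theorem isUnit_Z_of_body {z : Z} {r : ℝ} (h : bodyHom z = r) (hr : r ≠ 0) : IsUnit z :=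
  isUnit_Z (by rw [h]; exact_mod_cast hr)

theorem Separated.isUnit_e (hx : Separated x) : IsUnit (tX x 0 2 - tX x 1 2).det :=
  isUnit_Z_of_body bodyHom_e (hx 0 1 (by decide))

theorem Separated.isUnit_d (hx : Separated x) : IsUnit (tX x 0 3 - tX x 1 3).det :=
  isUnit_Z_of_body bodyHom_d (hx 0 1 (by decide))

theorem Separated.isUnit_g (hx : Separated x) : IsUnit (tX x 0 2 - tX x 0 3).det :=
  isUnit_Z_of_body bodyHom_g (hx 2 3 (by decide))

theorem Separated.isUnit_tX (hx : Separated x) {i j : Fin 4} (h : i ≠ j) : IsUnit (tX x i j).det :=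
  isUnit_det_tW _ _ _ (hx i j h)

theorem Separated.isUnit_xiSq (hx : Separated x) {i j : Fin 4} (h : i ≠ j) : IsUnit (xiSq x i j) :=
  SuperFourPoint.isUnit_xiSq x (hx i j h)

/-! ### Vanishing of the nilpotent invariants under the substitution -/

theorem inv_neg_mul_mul {K d : Matrix (Fin 2) (Fin 2) Z} (hK : IsUnit K.det) :
    (-(K * d))⁻¹ * K = (-d)⁻¹ := by
  rw [← mul_neg, Matrix.mul_inv_rev, mul_assoc, Matrix.nonsing_inv_mul K hK, mul_one]

theorem phi_mulVec_thetaBarD (hx : Separated x) {i j : Fin 4} (h : i ≠ j) (α : Fin 2) :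
    phi x ((xtInv x i j).mulVec (thetaBarD i j) α)
      = (act (tN x i j)⁻¹ (newThetaBar x i - newThetaBar x j) α : Gr) :=
  substS_xtInv_mulVec _ _ _ (hx i j h) α

theorem act_tN_three_zero (hx : Separated x) :
    act (tN x 3 0)⁻¹ (newThetaBar x 3 - newThetaBar x 0)
      = act (-(tX x 0 3 - tX x 1 3))⁻¹ (thetaBarO 1 - thetaBarO 0) := by
  have h : newThetaBar x 3 - newThetaBar x 0
      = act (tX x 0 3 * (tX x 0 3 - tX x 1 3)⁻¹) (thetaBarO 1 - thetaBarO 0) :=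
    add_sub_cancel_left _ _
  have hK : IsUnit (tX x 0 3 * (tX x 0 3 - tX x 1 3)⁻¹).det := by
    rw [Matrix.det_mul]
    exact (hx.isUnit_tX (by decide)).mul (Matrix.isUnit_nonsing_inv_det _ hx.isUnit_d)
  rw [h, act_act, ← inv_neg_mul_mul hK, mul_inv_cancel_of_isUnit hx.isUnit_d, tN_three_zero]

/-- The matrix `K` in the replaced `θbar_31` cancels against the factor `K` of the interval, leaving
the spinor of the pair of points 2 and 1. -/
theorem act_tN_two_zero (hx : Separated x) :
    act (tN x 2 0)⁻¹ (newThetaBar x 2 - newThetaBar x 0)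
      = act (-(tX x 0 3 - tX x 1 3))⁻¹ (thetaBarO 1 - thetaBarO 0) := by
  have h : newThetaBar x 2 - newThetaBar x 0
      = act (tX x 0 2 * (tX x 0 2 - tX x 1 2)⁻¹) (thetaBarO 1 - thetaBarO 0) :=
    add_sub_cancel_left _ _
  have hK : IsUnit (tX x 0 2 * (tX x 0 2 - tX x 1 2)⁻¹).det := by
    rw [Matrix.det_mul]
    exact (hx.isUnit_tX (by decide)).mul (Matrix.isUnit_nonsing_inv_det _ hx.isUnit_e)
  rw [h, act_act, ← inv_neg_mul_mul hK, tN_two_zero hx.isUnit_e]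

theorem act_tN_one_zero :
    act (tN x 1 0)⁻¹ (newThetaBar x 1 - newThetaBar x 0)
      = act (-(tX x 0 3 - tX x 1 3))⁻¹ (thetaBarO 1 - thetaBarO 0) := by
  rw [tN_one_zero]; rfl

/-- Each `Θtilde` is a difference of two spinors with the same image. As every nilpotent invariant
contains a `Θtilde`, the spinors `Θbartilde` need no separate treatment. -/
theorem phi_bigTheta (hx : Separated x) (i α : Fin 2) : phi x (bigTheta x i α) = 0 := by
  have hi : pt i ≠ 0 := by fin_cases i <;> decide
  rw [bigTheta, map_smul, map_sub, phi_mulVec_thetaBarD hx (by decide),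
    phi_mulVec_thetaBarD hx hi, act_tN_three_zero hx]
  have h : act (tN x (pt i) 0)⁻¹ (newThetaBar x (pt i) - newThetaBar x 0)
      = act (-(tX x 0 3 - tX x 1 3))⁻¹ (thetaBarO 1 - thetaBarO 0) := by
    fin_cases i
    · exact act_tN_one_zero
    · exact act_tN_two_zero hx
  rw [h, sub_self, smul_zero]

theorem phi_nilInv (hx : Separated x) (p : Fin 2 × Fin 2 × Fin 2) : phi x (nilInv x p) = 0 := by
  simp [nilInv, sandwich, phi_bigTheta hx]

theorem phi_nilMon (hx : Separated x) {e : Expo} (he : e ≠ 0) : phi x (nilMon x e) = 0 := by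
  obtain ⟨p, hp⟩ := Function.ne_iff.1 he
  have hp' : (e p : ℕ) ≠ 0 := fun h => hp (Fin.ext h)
  rw [nilMon, map_list_prod]
  apply List.prod_eq_zero
  rw [List.map_map, List.mem_map]
  have hmem : ∀ p : Fin 2 × Fin 2 × Fin 2, p ∈ [(0, 0, 0), (0, 0, 1), (0, 1, 0), (0, 1, 1),
      (1, 0, 0), (1, 0, 1), (1, 1, 0), (1, 1, 1)] := by decide
  refine ⟨p, hmem p, ?_⟩
  rw [Function.comp_apply, map_pow, phi_nilInv hx, zero_pow hp']

theorem nilMon_zero : nilMon x 0 = 1 := by simp [nilMon]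

theorem body_phi (a : Gr) : body (phi x a) = body a := bodyHom_substS _ _ a

/-- Odd images have no body, so the substitution preserves the bodies about which the Taylor
expansions are taken. -/
theorem phi_evalTwo (f : ℝ → ℝ → ℂ) (a b : Gr) :
    phi x (evalTwo f a b) = evalTwo f (phi x a) (phi x b) := by
  have hc : ∀ c, phi x (cst c) = cst c := fun c => AlgHom.commutes _ c
  simp only [evalTwo, map_sum, map_smul, map_mul, map_pow, map_sub, body_phi, hc]

theorem phi_fourPF (hx : Separated x) (f : Expo → ℝ → ℝ → ℂ) :
    phi x (fourPF f x) = evalTwo (f 0) (phi x (crossOne x)) (phi x (crossTwo x)) := by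
  rw [fourPF, map_sum, Finset.sum_eq_single 0]
  · rw [map_mul, nilMon_zero, map_one, mul_one, phi_evalTwo]
  · intro e _ he
    rw [map_mul, phi_nilMon hx he, mul_zero]
  · simp

/-! ### The modified cross ratio -/

theorem phi_inverse {a : Gr} (ha : IsUnit a) :
    phi x (Ring.inverse a) = Ring.inverse (phi x a) := substS_inverse _ _ ha

theorem phi_xiSq (i j : Fin 4) : phi x (xiSq x i j) = ((tN x i j).det : Z) := substS_xiSq _ _ _ _ _

theorem coe_ringInverse {z : Z} (hz : IsUnit z) :
    ((Ring.inverse z : Z) : Gr) = Ring.inverse (z : Gr) :=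
  map_ring_inverse (Z.val : Z →+* Gr) hz

/-- The quantity `γ` in the centre. -/
noncomputable def gammaZ (x : Config) : Z :=
  ((tX x 0 2 - tX x 0 3)⁻¹ * (tX x 0 2 * (tX x 0 2 - tX x 1 2)⁻¹) * oddM).trace

/-- The modified cross ratio without its exponential factor. -/
noncomputable def baseZ (x : Config) : Z :=
  (tX x 0 3).det * (tX x 1 2).det
    * Ring.inverse ((tX x 0 2 - tX x 1 2).det * (tX x 0 2 - tX x 0 3).det)

theorem isOddProduct_oddM : IsOddProduct oddM := isOddProduct_pairM _ _

theorem phi_crossOne (hx : Separated x) :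
    phi x (crossOne x) = ((1 + (4 * Complex.I) • gammaZ x) * baseZ x : Z) := by
  have h := isOddProduct_oddM.cross_ratio (4 * Complex.I) (b := tX x 1 2) hx.isUnit_d hx.isUnit_e
    hx.isUnit_g
  rw [← tN_two_one hx.isUnit_e, ← tN_two_three, ← tN_zero_one] at h
  have hu := (hx.isUnit_xiSq (show (0 : Fin 4) ≠ 1 by decide)).mul
    (hx.isUnit_xiSq (show (2 : Fin 4) ≠ 3 by decide))
  have h03 : tN x 0 3 = tX x 0 3 := by
    simp only [tN, tX, tW_eq]
    simp [newTheta, newThetaBar]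
  have hu' : IsUnit ((tN x 0 1).det * (tN x 2 3).det) :=
    (isUnit_det_tW _ _ _ (hx 0 1 (by decide))).mul (isUnit_det_tW _ _ _ (hx 2 3 (by decide)))
  rw [gammaZ, baseZ, ← h, crossOne, map_mul, map_mul, phi_inverse hu, map_mul]
  simp only [phi_xiSq, h03]
  rw [Subalgebra.coe_mul, Subalgebra.coe_mul, coe_ringInverse hu', Subalgebra.coe_mul]

theorem chiralSqOneTwo_eq : chiralSqOneTwo x = ((tX x 0 2 - tX x 1 2).det : Z) := by
  rw [tX, tX, tW, tW, ← tm_sub, ← sq_coe, chiralSqOneTwo]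
  simp only [xi_eq]
  rfl

theorem chiralSqThreeFour_eq : chiralSqThreeFour x = ((tX x 0 2 - tX x 0 3).det : Z) := by
  rw [tX, tX, tW, tW, ← tm_sub, ← sq_coe, chiralSqThreeFour]
  simp only [xi_eq]
  rfl

theorem sandwich_thetaD (K : Matrix (Fin 2) (Fin 2) Z) :
    sandwich (thetaD 2 3) (matCoe K) (thetaBarD 1 0) = ((K * oddM).trace : Z) :=
  sandwich_coe (thetaO 2 - thetaO 3) (thetaBarO 1 - thetaBarO 0) K

/-- Writing the inverses in `gammaZ` as adjugates over determinants produces the common denominator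
`N`; `trace_expand` supplies the numerator. -/
theorem gammaNil_eq (hx : Separated x) : gammaNil x = (gammaZ x : Gr) := by
  have h : gammaZ x = ((tX x 0 3).adjugate * tX x 0 2 * (tX x 1 2).adjugate * oddM).trace
        * Ring.inverse ((tX x 0 2 - tX x 1 2).det * (tX x 0 2 - tX x 0 3).det)
      - (tX x 0 2).det * (((tX x 1 2).adjugate * oddM).trace + ((tX x 0 3).adjugate * oddM).trace
          - ((tX x 0 2).adjugate * oddM).trace)
        * Ring.inverse ((tX x 0 2 - tX x 1 2).det * (tX x 0 2 - tX x 0 3).det) := by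
    rw [← sub_mul, ← IsOddProduct.trace_expand, gammaZ, Matrix.inv_def, Matrix.inv_def,
      Ring.inverse_mul (Or.inl hx.isUnit_e)]
    simp only [Matrix.mul_smul, Matrix.smul_mul, Matrix.trace_smul, smul_eq_mul]
    ring
  rw [h, gammaNil, chiralSqOneTwo_eq, chiralSqThreeFour_eq, xm_eq, xm_eq, xm_eq, xt_eq,
    ← matCoe_mul, ← matCoe_mul, xiSq_eq]
  simp only [sandwich_thetaD]
  rw [← Subalgebra.coe_mul, ← coe_ringInverse (hx.isUnit_e.mul hx.isUnit_g)]
  simp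

/-- The exponent is `4ig + 8g²`, that is, `log (1 + 4ig)` truncated at `g ^ 3 = 0`; half its square
is `-8g²`. -/
theorem exp_eq_one_add {g : Gr} (hg : g ^ 3 = 0) :
    IsNilpotent.exp ((4 * Complex.I) • (g - (2 * Complex.I) • g ^ 2)) = 1 + (4 * Complex.I) • g := by
  have h8 : (4 * Complex.I) * (2 * Complex.I) = -8 := by
    linear_combination 8 * Complex.I_mul_I
  have h16 : (4 * Complex.I) * (4 * Complex.I) = -16 := by
    linear_combination 16 * Complex.I_mul_I
  have hw : (4 * Complex.I) • (g - (2 * Complex.I) • g ^ 2)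
      = (4 * Complex.I) • g + (8 : ℂ) • g ^ 2 := by
    rw [smul_sub, smul_smul, h8, neg_smul, sub_neg_eq_add]
  have h12 : g * g ^ 2 = 0 := by rw [← pow_succ', hg]
  have h21 : g ^ 2 * g = 0 := by rw [← pow_succ, hg]
  have h22 : g ^ 2 * g ^ 2 = 0 := by rw [pow_two g, mul_assoc, ← pow_two g, h12, mul_zero]
  have hw2 : ((4 * Complex.I) • g + (8 : ℂ) • g ^ 2) ^ 2 = (-16 : ℂ) • g ^ 2 := by
    rw [pow_two, mul_add, add_mul, add_mul]
    simp only [smul_mul_smul_comm, h12, h21, h22, smul_zero, add_zero, h16, ← pow_two g]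
  have hw3 : ((4 * Complex.I) • g + (8 : ℂ) • g ^ 2) ^ 3 = 0 := by
    rw [pow_succ', hw2, add_mul, smul_mul_smul_comm, smul_mul_smul_comm, h12, h22]
    simp
  rw [hw, IsNilpotent.exp_eq_sum hw3, Finset.sum_range_succ, Finset.sum_range_succ,
    Finset.sum_range_one, hw2, ← Rat.cast_smul_eq_qsmul ℂ, ← Rat.cast_smul_eq_qsmul ℂ,
    ← Rat.cast_smul_eq_qsmul ℂ, smul_smul, add_assoc, pow_zero, pow_one]
  norm_num

theorem crossOnePrime_eq (hx : Separated x) :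
    crossOnePrime x = ((1 + (4 * Complex.I) • gammaZ x) * baseZ x : Z) := by
  have h3 : gammaZ x ^ 3 = 0 := isOddProduct_oddM.trace_pow_three _
  have h3' : (gammaZ x : Gr) ^ 3 = 0 := by
    rw [← Subalgebra.coe_pow, h3]; rfl
  rw [crossOnePrime, gammaNil_eq hx, exp_eq_one_add h3', chiralSqOneTwo_eq, chiralSqThreeFour_eq,
    xiSq_eq, xiSq_eq, baseZ, Subalgebra.coe_mul, Subalgebra.coe_mul, Subalgebra.coe_mul,
    coe_ringInverse (hx.isUnit_e.mul hx.isUnit_g), Subalgebra.coe_mul]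
  simp

end

/-! ### Chirality of the ingredients -/

section

variable {x : Config}

theorem theta_mem_Chi {i : Fin 4} (hi : i = 2 ∨ i = 3) (α : Fin 2) : theta i α ∈ Chi :=
  gen_mem_Chi (k := Sum.inl (i, α)) (by rcases hi with rfl | rfl <;> fin_cases α <;> decide)

theorem thetaBar_mem_Chi {i : Fin 4} (hi : i = 0 ∨ i = 1) (α : Fin 2) : thetaBar i α ∈ Chi :=
  gen_mem_Chi (k := Sum.inr (i, α)) (by rcases hi with rfl | rfl <;> fin_cases α <;> decide)

theorem cst_mem_Chi (c : ℂ) : cst c ∈ Chi := Chi.algebraMap_mem c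

theorem xi_mem_Chi {i j : Fin 4} (hi : i = 0 ∨ i = 1) (hj : j = 2 ∨ j = 3) (μ : Fin 4) :
    xi x i j μ ∈ Chi := by
  have hj' : ¬(j = 0 ∨ j = 1) := by rcases hj with rfl | rfl <;> decide
  rw [xi, xMinus, xPlus, if_pos hi, if_neg hj']
  refine Chi.sub_mem (Chi.sub_mem (cst_mem_Chi _) (cst_mem_Chi _)) (Chi.smul_mem ?_ _)
  exact Chi.sum_mem fun α _ => Chi.sum_mem fun β _ =>
    Chi.smul_mem (Chi.mul_mem (theta_mem_Chi hj α) (thetaBar_mem_Chi hi β)) _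

theorem sq_mem_Chi {v : Fin 4 → Gr} (hv : ∀ μ, v μ ∈ Chi) : sq v ∈ Chi :=
  Chi.sum_mem fun μ _ => Chi.smul_mem (Chi.mul_mem (hv μ) (hv μ)) _

theorem slash_mem_Chi {v : Fin 4 → Gr} (hv : ∀ μ, v μ ∈ Chi) (α β : Fin 2) : slash v α β ∈ Chi :=
  Chi.sum_mem fun μ _ => Chi.smul_mem (hv μ) _

theorem slashTilde_mem_Chi {v : Fin 4 → Gr} (hv : ∀ μ, v μ ∈ Chi) (α β : Fin 2) :
    slashTilde v α β ∈ Chi :=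
  Chi.sum_mem fun μ _ => Chi.smul_mem (hv μ) _

theorem xiSq_mem_Chi {i j : Fin 4} (hi : i = 0 ∨ i = 1) (hj : j = 2 ∨ j = 3) : xiSq x i j ∈ Chi :=
  sq_mem_Chi (xi_mem_Chi hi hj)

theorem matrix_mul_mem_Chi {A B : Matrix (Fin 2) (Fin 2) Gr} (hA : ∀ i j, A i j ∈ Chi)
    (hB : ∀ i j, B i j ∈ Chi) (i j : Fin 2) : (A * B) i j ∈ Chi := by
  rw [Matrix.mul_apply]
  exact Chi.sum_mem fun k _ => Chi.mul_mem (hA i k) (hB k j)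

theorem sandwich_mem_Chi {A : Matrix (Fin 2) (Fin 2) Gr} (hA : ∀ i j, A i j ∈ Chi) :
    sandwich (thetaD 2 3) A (thetaBarD 1 0) ∈ Chi :=
  Chi.sum_mem fun α _ => Chi.sum_mem fun β _ => Chi.mul_mem (Chi.mul_mem
    (Chi.sub_mem (theta_mem_Chi (by decide) α) (theta_mem_Chi (by decide) α)) (hA α β))
    (Chi.sub_mem (thetaBar_mem_Chi (by decide) β) (thetaBar_mem_Chi (by decide) β))

theorem inverse_chiralSq_mem_Chi :
    Ring.inverse (chiralSqOneTwo x * chiralSqThreeFour x) ∈ Chi :=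
  inverse_mem_Chi (Chi.mul_mem
    (sq_mem_Chi fun μ => Chi.sub_mem (xi_mem_Chi (by decide) (by decide) μ)
      (xi_mem_Chi (by decide) (by decide) μ))
    (sq_mem_Chi fun μ => Chi.sub_mem (xi_mem_Chi (by decide) (by decide) μ)
      (xi_mem_Chi (by decide) (by decide) μ)))

theorem gammaNil_mem_Chi : gammaNil x ∈ Chi := by
  have hm : ∀ {i j : Fin 4}, (i = 0 ∨ i = 1) → (j = 2 ∨ j = 3) → ∀ α β, xm x i j α β ∈ Chi :=
    fun hi hj => slash_mem_Chi (xi_mem_Chi hi hj)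
  have ht : ∀ {i j : Fin 4}, (i = 0 ∨ i = 1) → (j = 2 ∨ j = 3) → ∀ α β, xt x i j α β ∈ Chi :=
    fun hi hj => slashTilde_mem_Chi (xi_mem_Chi hi hj)
  refine Chi.sub_mem (Chi.mul_mem (sandwich_mem_Chi ?_) inverse_chiralSq_mem_Chi)
    (Chi.mul_mem (Chi.mul_mem (xiSq_mem_Chi (by decide) (by decide)) (Chi.sub_mem (Chi.add_mem
      (sandwich_mem_Chi (hm (by decide) (by decide)))
      (sandwich_mem_Chi (hm (by decide) (by decide))))
      (sandwich_mem_Chi (hm (by decide) (by decide))))) inverse_chiralSq_mem_Chi)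
  exact matrix_mul_mem_Chi (matrix_mul_mem_Chi (hm (by decide) (by decide))
    (ht (by decide) (by decide))) (hm (by decide) (by decide))

theorem gammaNil_pow_three (hx : Separated x) : gammaNil x ^ 3 = 0 := by
  have h3 : gammaZ x ^ 3 = 0 := isOddProduct_oddM.trace_pow_three _
  rw [gammaNil_eq hx, ← Subalgebra.coe_pow, h3]; rfl

theorem crossOnePrime_mem_Chi (hx : Separated x) : crossOnePrime x ∈ Chi := by
  rw [crossOnePrime, exp_eq_one_add (gammaNil_pow_three hx)]
  exact Chi.mul_mem (Chi.add_mem Chi.one_mem (Chi.smul_mem gammaNil_mem_Chi _))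
    (Chi.mul_mem (Chi.mul_mem (xiSq_mem_Chi (by decide) (by decide))
      (xiSq_mem_Chi (by decide) (by decide))) inverse_chiralSq_mem_Chi)

theorem crossTwo_mem_Chi : crossTwo x ∈ Chi :=
  Chi.mul_mem (Chi.mul_mem (xiSq_mem_Chi (by decide) (by decide))
    (xiSq_mem_Chi (by decide) (by decide)))
    (inverse_mem_Chi (Chi.mul_mem (xiSq_mem_Chi (by decide) (by decide))
      (xiSq_mem_Chi (by decide) (by decide))))

theorem powLog_mem_Chi (s : ℝ) (l : ℂ) {a : Gr} (ha : a ∈ Chi) : powLog s l a ∈ Chi :=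
  Chi.smul_mem (Chi.sum_mem fun k _ => Chi.smul_mem
    (Chi.pow_mem (Chi.sub_mem (Chi.smul_mem ha _) Chi.one_mem) k) _) _

theorem prefactor_mem_Chi (η : Fin 4 → ℝ) (l : Fin 4 → Fin 4 → ℂ) : prefactor η l x ∈ Chi :=
  Chi.mul_mem (Chi.mul_mem (powLog_mem_Chi _ _ (xiSq_mem_Chi (by decide) (by decide)))
    (powLog_mem_Chi _ _ (xiSq_mem_Chi (by decide) (by decide))))
    (powLog_mem_Chi _ _ (xiSq_mem_Chi (by decide) (by decide)))

/-! ### Bodies and units -/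

theorem bodyHom_inverse {a : Gr} (ha : IsUnit a) :
    bodyHom (Ring.inverse a) = (bodyHom a)⁻¹ := by
  rw [← Ring.inverse_eq_inv']
  exact map_ring_inverse (bodyHom : Gr →+* ℂ) ha

theorem xiSq_mem_Z (i j : Fin 4) : xiSq x i j ∈ Z := by
  rw [xiSq_eq]; exact Subtype.prop _

theorem bodyHom_powLog {s : ℝ} {l : ℂ} {a : Gr} (h : Complex.exp l = bodyHom a) :
    bodyHom (powLog s l a) = Complex.exp (s * l) := by
  have h0 : bodyHom (Complex.exp (-l) • a - 1) = 0 := by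
    rw [map_sub, map_smul, map_one, ← h, smul_eq_mul, ← Complex.exp_add, neg_add_cancel,
      Complex.exp_zero, sub_self]
  rw [powLog, map_smul, binom, map_sum, Finset.sum_eq_single 0]
  · simp
  · intro k _ hk
    rw [map_smul, map_pow, h0, zero_pow hk, smul_zero]
  · simp

theorem powLog_zero (l : ℂ) (a : Gr) : powLog 0 l a = 1 := by
  rw [powLog, binom, Finset.sum_eq_single 0]
  · simp
  · intro k _ hk
    rw [Ring.choose_zero_pos ℝ (Nat.pos_of_ne_zero hk)]; simp
  · simp

theorem powLog_mem_Z (s : ℝ) (l : ℂ) {a : Gr} (ha : a ∈ Z) : powLog s l a ∈ Z :=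
  Z.smul_mem (Z.sum_mem fun k _ => Z.smul_mem
    (Z.pow_mem (Z.sub_mem (Z.smul_mem ha _) Z.one_mem) k) _) _

theorem prefactor_mem_Z (η : Fin 4 → ℝ) (l : Fin 4 → Fin 4 → ℂ) : prefactor η l x ∈ Z :=
  Z.mul_mem (Z.mul_mem (powLog_mem_Z _ _ (xiSq_mem_Z _ _)) (powLog_mem_Z _ _ (xiSq_mem_Z _ _)))
    (powLog_mem_Z _ _ (xiSq_mem_Z _ _))

theorem bodyHom_prefactor (η : Fin 4 → ℝ) {l : Fin 4 → Fin 4 → ℂ}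
    (hl : ∀ i j, i ≠ j → Complex.exp (l i j) = mink x i j) :
    bodyHom (prefactor η l x) = confPrefactor η l := by
  have h : ∀ i j, i ≠ j → Complex.exp (l i j) = bodyHom (xiSq x i j) := fun i j hij => by
    rw [hl i j hij, bodyHom_xiSq]
  rw [prefactor, map_mul, map_mul, bodyHom_powLog (h 0 2 (by decide)),
    bodyHom_powLog (h 0 3 (by decide)), bodyHom_powLog (h 1 2 (by decide)), confPrefactor]
  push_cast
  rfl

theorem confPrefactor_ne_zero (η : Fin 4 → ℝ) (l : Fin 4 → Fin 4 → ℂ) : confPrefactor η l ≠ 0 :=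
  mul_ne_zero (mul_ne_zero (Complex.exp_ne_zero _) (Complex.exp_ne_zero _)) (Complex.exp_ne_zero _)

theorem isUnit_prefactor (η : Fin 4 → ℝ) {l : Fin 4 → Fin 4 → ℂ}
    (hl : ∀ i j, i ≠ j → Complex.exp (l i j) = mink x i j) : IsUnit (prefactor η l x) :=
  isUnit_of_mem_Z (prefactor_mem_Z η l)
    (by rw [bodyHom_prefactor η hl]; exact confPrefactor_ne_zero η l)

theorem crossTwo_mem_Z (hx : Separated x) : crossTwo x ∈ Z := by
  have hu : IsUnit ((tX x 0 2).det * (tX x 1 3).det) :=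
    (hx.isUnit_tX (by decide)).mul (hx.isUnit_tX (by decide))
  rw [crossTwo, xiSq_eq, xiSq_eq, xiSq_eq, xiSq_eq, ← Subalgebra.coe_mul, ← Subalgebra.coe_mul,
    ← coe_ringInverse hu, ← Subalgebra.coe_mul]
  exact Subtype.prop _

theorem bodyHom_crossTwo (hx : Separated x) : bodyHom (crossTwo x) = confTwo x := by
  have hu := (hx.isUnit_xiSq (show (0 : Fin 4) ≠ 2 by decide)).mul
    (hx.isUnit_xiSq (show (1 : Fin 4) ≠ 3 by decide))
  rw [crossTwo, map_mul, map_mul, bodyHom_inverse hu, map_mul]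
  simp only [bodyHom_xiSq, confTwo]
  push_cast
  rw [div_eq_mul_inv]

theorem crossOnePrime_mem_Z (hx : Separated x) : crossOnePrime x ∈ Z := by
  rw [crossOnePrime_eq hx]; exact Subtype.prop _

theorem bodyHom_crossOne (hx : Separated x) : bodyHom (crossOne x) = confOne x := by
  have hu := (hx.isUnit_xiSq (show (0 : Fin 4) ≠ 1 by decide)).mul
    (hx.isUnit_xiSq (show (2 : Fin 4) ≠ 3 by decide))
  rw [crossOne, map_mul, map_mul, bodyHom_inverse hu, map_mul]
  simp only [bodyHom_xiSq, confOne, mink_comm 2 1]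
  push_cast
  rw [div_eq_mul_inv]

theorem phi_crossOne_eq (hx : Separated x) : phi x (crossOne x) = crossOnePrime x :=
  (phi_crossOne hx).trans (crossOnePrime_eq hx).symm

/-- The modified cross ratio is the image of the original one under a body-preserving substitution.
-/
theorem bodyHom_crossOnePrime (hx : Separated x) : bodyHom (crossOnePrime x) = confOne x := by
  rw [← phi_crossOne_eq hx, ← bodyHom_crossOne hx]; exact bodyHom_substS _ _ _

theorem Separated.confOne_ne_zero (hx : Separated x) : confOne x ≠ 0 :=
  div_ne_zero (mul_ne_zero (hx 0 3 (by decide)) (hx 1 2 (by decide)))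
    (mul_ne_zero (hx 0 1 (by decide)) (hx 2 3 (by decide)))

theorem Separated.confTwo_ne_zero (hx : Separated x) : confTwo x ≠ 0 :=
  div_ne_zero (mul_ne_zero (hx 0 3 (by decide)) (hx 1 2 (by decide)))
    (mul_ne_zero (hx 0 2 (by decide)) (hx 1 3 (by decide)))

theorem sub_cst_pow_seventeen {a : Gr} {c : ℂ} (ha : a ∈ Z) (h : bodyHom a = c) :
    (a - cst c) ^ 17 = 0 := by
  have hc : bodyHom (cst c) = c := AlgHom.commutes _ c
  exact pow_seventeen_eq_zero (Z.sub_mem ha (Z.algebraMap_mem c)) (by rw [map_sub, h, hc, sub_self])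

theorem bodyHom_intPow {a : Gr} (ha : IsUnit a) (k : ℤ) : bodyHom (intPow a k) = bodyHom a ^ k := by
  obtain ⟨w, rfl⟩ := ha
  rw [intPow_unit]
  have h := congrArg Units.val (map_zpow (Units.map (bodyHom : Gr →* ℂ)) w k)
  rw [Units.val_zpow_eq_zpow_val] at h
  exact h

/-! ### Vanishing total R-charge and chirality -/

/-- At vanishing total R-charge the three sums of `Delta` reduce to `(η - 3κ) / 2` at the first
point and `(η + 3κ) / 2` at the third and fourth. The chirality values of `κ` make these zero; the
last exponent is a multiple of the total R-charge. -/
theorem scalarFourPoint_eq {η κ : Fin 4 → ℝ} (hκ₀ : κ 0 = η 0 / 3) (hκ₁ : κ 1 = η 1 / 3)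
    (hκ₂ : κ 2 = -(η 2 / 3)) (hκ₃ : κ 3 = -(η 3 / 3)) (hκ : ∑ i, κ i = 0)
    (f : Expo → ℝ → ℝ → ℂ) (l : Fin 4 → Fin 4 → ℂ) (x : Config) :
    scalarFourPoint η κ f l x = fourPF f x * Ring.inverse (prefactor η l x) := by
  rw [Fin.sum_univ_four] at hκ
  have h1 : Delta η κ 1 0 + Delta η κ 2 0 + Delta η κ 3 0 = 0 := by
    simp only [Delta, Fin.sum_univ_four]; linarith
  have h2 : Delta η κ 2 0 + Delta η κ 2 1 + Delta η κ 2 3 = 0 := by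
    simp only [Delta, Fin.sum_univ_four]; linarith
  have h3 : Delta η κ 3 0 + Delta η κ 3 1 + Delta η κ 3 2 = 0 := by
    simp only [Delta, Fin.sum_univ_four]; linarith
  have h4 : (η 0 + η 1 - η 2 - η 3) / 2 = 0 := by linarith
  rw [scalarFourPoint, h1, h2, h3, h4]
  simp only [powLog_zero, one_mul]

/-- Chirality makes `phi` act trivially on the left side, while its definition removes every term
except `f 0`. -/
theorem fourPF_eq_evalTwo (hx : Separated x) {f : Expo → ℝ → ℝ → ℂ} (h : fourPF f x ∈ Chi) :
    fourPF f x = evalTwo (f 0) (crossOnePrime x) (crossTwo x) := by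
  rw [← phi_eq_self x h, phi_fourPF hx, phi_crossOne_eq hx, phi_eq_self x crossTwo_mem_Chi]

end

end SuperFourPoint

theorem mainTheorem3
    -- a domain of configurations with non-lightlike separations, values of `log x_{ij}^2` on it
    (U : Set SuperFourPoint.Config)
    (hU : ∀ x ∈ U, ∀ i j : Fin 4, i ≠ j → SuperFourPoint.mink x i j ≠ 0)
    (l : SuperFourPoint.Config → Fin 4 → Fin 4 → ℂ)
    (hl : ∀ x ∈ U, ∀ i j : Fin 4, i ≠ j →
      Complex.exp (l x i j) = (SuperFourPoint.mink x i j : ℂ))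
    -- a domain of cross ratios
    (V : Set (ℝ × ℝ)) (hV : IsOpen V)
    (hUV : ∀ x ∈ U, (SuperFourPoint.confOne x, SuperFourPoint.confTwo x) ∈ V)
    -- dimensions and R-charges of two anti-chiral and two chiral scalar superfields
    (η κ : Fin 4 → ℝ)
    (hκ₀ : κ 0 = η 0 / 3) (hκ₁ : κ 1 = η 1 / 3) (hκ₂ : κ 2 = -(η 2 / 3)) (hκ₃ : κ 3 = -(η 3 / 3))
    (hκ : ∑ i, κ i = 0)
    -- a chiral four-point function with these quantum numbers
    (f : SuperFourPoint.Expo → ℝ → ℝ → ℂ)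
    (hf : ∀ e, ContDiffOn ℝ (⊤ : ℕ∞) (fun p : ℝ × ℝ => f e p.1 p.2) V)
    (G : SuperFourPoint.Config → SuperFourPoint.Gr)
    (hG : ∀ x ∈ U, G x = SuperFourPoint.scalarFourPoint η κ f (l x) x)
    (hchiral : ∀ x ∈ U, SuperFourPoint.IsChiral (G x))
    -- the power series of `f_{0,1}`
    (a : ℤ × ℤ → ℂ)
    (ha : ∀ p ∈ V, p.1 ≠ 0 → p.2 ≠ 0 →
      HasSum (fun k : ℤ × ℤ => a k * (p.1 : ℂ) ^ k.1 * (p.2 : ℂ) ^ k.2) (f 0 p.1 p.2)) :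
    ∀ x ∈ U,
      -- the four-point function is the same series in `𝓘₁'` and `𝓘₂` over the prefactor
      (∃ S : SuperFourPoint.Gr,
        SuperFourPoint.GrHasSum (fun k : ℤ × ℤ =>
          a k • (SuperFourPoint.intPow (SuperFourPoint.crossOnePrime x) k.1
            * SuperFourPoint.intPow (SuperFourPoint.crossTwo x) k.2)) S ∧
        G x = S * Ring.inverse (SuperFourPoint.prefactor η (l x) x)) ∧
      -- all its ingredients depend on the chiral and anti-chiral variables only
      SuperFourPoint.IsChiral (SuperFourPoint.crossOnePrime x) ∧
      SuperFourPoint.IsChiral (SuperFourPoint.crossTwo x) ∧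
      SuperFourPoint.IsChiral (SuperFourPoint.prefactor η (l x) x) ∧
      -- for vanishing Grassmann variables: the four-point function of the lowest components, in the
      -- conformal cross ratios, with the same coefficients
      SuperFourPoint.body (SuperFourPoint.crossOnePrime x) = (SuperFourPoint.confOne x : ℂ) ∧
      SuperFourPoint.body (SuperFourPoint.crossTwo x) = (SuperFourPoint.confTwo x : ℂ) ∧
      ∃ s : ℂ,
        HasSum (fun k : ℤ × ℤ =>
          a k * (SuperFourPoint.confOne x : ℂ) ^ k.1 * (SuperFourPoint.confTwo x : ℂ) ^ k.2) s ∧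
        SuperFourPoint.body (G x) = s / SuperFourPoint.confPrefactor η (l x) := by
  intro x hxU
  have hx : SuperFourPoint.Separated x := hU x hxU
  have hunit := SuperFourPoint.isUnit_prefactor η (hl x hxU)
  have hPchi := SuperFourPoint.prefactor_mem_Chi (x := x) η (l x)
  have hGx := (hG x hxU).trans
    (SuperFourPoint.scalarFourPoint_eq hκ₀ hκ₁ hκ₂ hκ₃ hκ f (l x) x)
  -- Multiplying `G` back by the chiral, invertible prefactor transfers chirality to the invariant
  -- part.
  have hF : SuperFourPoint.fourPF f x ∈ SuperFourPoint.Chi := by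
    have h := SuperFourPoint.Chi.mul_mem
      (SuperFourPoint.isChiral_iff_mem_Chi.1 (hchiral x hxU)) hPchi
    rwa [hGx, mul_assoc, Ring.inverse_mul_cancel _ hunit, mul_one] at h
  rw [SuperFourPoint.fourPF_eq_evalTwo hx hF] at hGx
  have hb1 := SuperFourPoint.bodyHom_crossOnePrime hx
  have hb2 := SuperFourPoint.bodyHom_crossTwo hx
  have hZ1 := SuperFourPoint.crossOnePrime_mem_Z hx
  have hZ2 := SuperFourPoint.crossTwo_mem_Z hx
  have hu1 : IsUnit (SuperFourPoint.crossOnePrime x) := SuperFourPoint.isUnit_of_mem_Z hZ1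
    (by rw [hb1]; exact_mod_cast hx.confOne_ne_zero)
  have hu2 : IsUnit (SuperFourPoint.crossTwo x) := SuperFourPoint.isUnit_of_mem_Z hZ2
    (by rw [hb2]; exact_mod_cast hx.confTwo_ne_zero)
  have hsum := SuperFourPoint.grHasSum_evalTwo hV ha (hUV x hxU) hx.confOne_ne_zero
    hx.confTwo_ne_zero hb1 hb2 (SuperFourPoint.sub_cst_pow_seventeen hZ1 hb1)
    (SuperFourPoint.sub_cst_pow_seventeen hZ2 hb2) hu1 hu2
  refine ⟨⟨_, hsum, hGx⟩,
    SuperFourPoint.isChiral_iff_mem_Chi.2 (SuperFourPoint.crossOnePrime_mem_Chi hx),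
    SuperFourPoint.isChiral_iff_mem_Chi.2 SuperFourPoint.crossTwo_mem_Chi,
    SuperFourPoint.isChiral_iff_mem_Chi.2 hPchi, hb1, hb2,
    SuperFourPoint.bodyHom (SuperFourPoint.evalTwo (f 0) (SuperFourPoint.crossOnePrime x)
      (SuperFourPoint.crossTwo x)), ?_, ?_⟩
  -- Taking bodies is one of the linear forms that test the convergence, so the bosonic series keeps
  -- the same coefficients.
  · refine (hsum SuperFourPoint.bodyHom.toLinearMap).congr_fun fun k => ?_
    rw [AlgHom.toLinearMap_apply, map_smul, map_mul, SuperFourPoint.bodyHom_intPow hu1,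
      SuperFourPoint.bodyHom_intPow hu2, hb1, hb2, smul_eq_mul, mul_assoc]
  · rw [← SuperFourPoint.bodyHom_apply, hGx, map_mul, SuperFourPoint.bodyHom_inverse hunit,
      SuperFourPoint.bodyHom_prefactor η (hl x hxU), div_eq_mul_inv]
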